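/- Let $k\ge 1$ be an integer. **Structures.** In this statement, a structure $\mathbf A$ in a language $L$ of relation and function symbols has a vertex set $A$, a relation $R_{\mathbf A}\subseteq A^n$ for every $n$-ary relation symbol $R$ and a set-valued function $F_{\mathbf A}\colon A^n\to\mathcal P(A)$ for every $n$-ary function symbol $F$. An embedding $f\colon\mathbf A\to\mathbf B$ is an injection $A\to B$ with $\bar x\in R_{\mathbf A}\iff f(\bar x)\in R_{\mathbf B}$ and $f(F_{\mathbf A}(\bar x))=F_{\mathbf B}(f(\bar x))$ for all symbols $R,F$ and all tuples $\bar x$; an isomorphism is a bijective embedding. Substructures are the structures for which the inclusion is an embedding, i.e. the structures induced on subsets closed under all functions. $\mathbf A$ is the free amalgamation of its substructures $\mathbf S,\mathbf T$ if $A=S\cup T$ and every tuple that contains both a vertex of $S\setminus T$ and a vertex of $T\setminus S$ is in no relation and has value $\emptyset$ under all functions; $\mathbf A$ is irreducible if it is not the free amalgamation of two proper substructures. A partial automorphism of $\mathbf A$ is an isomorphism between two substructures of $\mathbf A$. A triple $(f,g,h)$ of partial automorphisms is coherent if $\mathrm{Dom}(f)=\mathrm{Dom}(h)$, $\mathrm{Range}(f)=\mathrm{Dom}(g)$,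 $\mathrm{Range}(g)=\mathrm{Range}(h)$ and $h=g\circ f$. **The class $\mathcal D^k_d$.** A $k$-orientation is an oriented graph $\mathbf G$ (a directed graph without loops and without pairs of opposite edges) in which every vertex has out-degree at most $k$; a root is a vertex of out-degree less than $k$. For $y\in G$ let $\mathrm{roots}(y)$ be the set of all roots of $\mathbf G$ that are reachable from $y$ by a directed path (possibly of length $0$). Let $L_d$ be the language with one binary relation symbol $E$, one unary function symbol $F$, and one $n$-ary function symbol $F_n$ for every $n\ge 1$. Let $d(s(\mathbf G))$ be the $L_d$-structure on the vertex set of $\mathbf G$ in which $E$ is the edge relation, $F(x)=\{y : y \text{ is reachable from } x\}$, and $$F_n(x_1,\dots,x_n)=\{y : \mathrm{roots}(y)=\{x_1,\dots,x_n\}\}$$ if $x_1,\dots,x_n$ are distinct roots, while $F_n(x_1,\dots,x_n)=\emptyset$ otherwise. Let $\mathcal D^k_d$ be the class of all structures $d(s(\mathbf G))$, where $\mathbf G$ is a finite $k$-orientation. **Theorem.** $\mathcal D^k_d$ has irreducible structure faithful coherent EPPA. That is, for every $\mathbf A\in\mathcal D^k_d$ there are $\mathbf B\in\mathcal D^k_d$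 and an embedding $\psi\colon\mathbf A\to\mathbf B$ such that 1. every partial automorphism $f$ of $\psi(\mathbf A)$ extends to an automorphism $\hat f$ of $\mathbf B$, and these extensions can be chosen so that $\hat h=\hat g\circ\hat f$ for every coherent triple $(f,g,h)$ of partial automorphisms of $\psi(\mathbf A)$; 2. for every irreducible substructure $\mathbf C$ of $\mathbf B$ there is an automorphism $g$ of $\mathbf B$ with $g(C)\subseteq\psi(A)$. -/

import Mathlib

universe u v

namespace SetValued

/-- A structure in the language `L` on the vertex set `A`, where functions take *sets of vertices*
as values: an `n`-ary function symbol is interpreted by a map `Aⁿ → 𝒫(A)` and an `n`-ary relation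
symbol by a subset of `Aⁿ`.  (The language carries the trivial permutation group.) -/
structure Struc (L : FirstOrder.Language.{0, 0}) (A : Type u) where
  /-- the interpretation of the function symbols -/
  func : ∀ {n : ℕ}, L.Functions n → (Fin n → A) → Set A
  /-- the interpretation of the relation symbols -/
  rel : ∀ {n : ℕ}, L.Relations n → (Fin n → A) → Prop

variable {L : FirstOrder.Language.{0, 0}} {A : Type u} {B : Type v}

/-- Embeddings: injective maps which preserve and reflect all relations and satisfy
`f (F_A(x₁, …, xₙ)) = F_B(f x₁, …, f xₙ)` for every function symbol `F`. -/
structure Embed (M : Struc L A) (N : Struc L B) where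
  /-- the map on vertices -/
  toFun : A → B
  injective : Function.Injective toFun
  map_rel : ∀ {n : ℕ} (R : L.Relations n) (x : Fin n → A), M.rel R x ↔ N.rel R (toFun ∘ x)
  map_func : ∀ {n : ℕ} (F : L.Functions n) (x : Fin n → A),
    toFun '' M.func F x = N.func F (toFun ∘ x)

/-- Isomorphisms: embeddings which are bijective on vertices. -/
structure Iso (M : Struc L A) (N : Struc L B) where
  /-- the bijection on vertices -/
  toEquiv : A ≃ B
  map_rel : ∀ {n : ℕ} (R : L.Relations n) (x : Fin n → A), M.rel R x ↔ N.rel R (toEquiv ∘ x)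
  map_func : ∀ {n : ℕ} (F : L.Functions n) (x : Fin n → A),
    toEquiv '' M.func F x = N.func F (toEquiv ∘ x)

/-- Automorphisms. -/
abbrev Aut (M : Struc L A) : Type u := Iso M M

/-- A substructure of `M`, given by its vertex set, which has to be closed under all functions. -/
structure Sub (M : Struc L A) where
  /-- the vertex set -/
  verts : Set A
  closed : ∀ {n : ℕ} (F : L.Functions n) (x : Fin n → A), (∀ i, x i ∈ verts) →
    M.func F x ⊆ verts

/-- A substructure, as a structure on its own vertex set. -/
def Sub.struc {M : Struc L A} (S : Sub M) : Struc L S.verts where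
  func F x := {y | (y : A) ∈ M.func F (fun i => (x i : A))}
  rel R x := M.rel R (fun i => (x i : A))

/-- The vertex set of the smallest substructure of `M` containing the set `X`. -/
def closure (M : Struc L A) (X : Set A) : Set A :=
  ⋂ S : {S : Sub M // X ⊆ S.verts}, S.1.verts

/-- `M` is the free amalgamation of its substructures `S` and `T` (over their intersection):
`S` and `T` cover `M`, and a tuple with vertices both in `S \ T` and in `T \ S` lies in no relation
and is sent to `∅` by all functions. -/
def IsFreeAmalgamation (M : Struc L A) (S T : Sub M) : Prop :=
  S.verts ∪ T.verts = Set.univ ∧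
  ∀ (n : ℕ) (x : Fin n → A),
    (∃ i, x i ∈ S.verts \ T.verts) → (∃ j, x j ∈ T.verts \ S.verts) →
      (∀ R : L.Relations n, ¬ M.rel R x) ∧ (∀ F : L.Functions n, M.func F x = ∅)

/-- A structure is irreducible if it is not the free amalgamation of two proper substructures. -/
def IsIrreducible (M : Struc L A) : Prop :=
  ¬ ∃ S T : Sub M, S.verts ≠ Set.univ ∧ T.verts ≠ Set.univ ∧ IsFreeAmalgamation M S T

/-- A partial automorphism of `M`: an isomorphism between two substructures of `M`. -/
structure PartialAut (M : Struc L A) where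
  /-- the domain -/
  dom : Sub M
  /-- the range -/
  ran : Sub M
  /-- the isomorphism -/
  iso : Iso dom.struc ran.struc

/-- Coherent triples `(f, g, h)`: `Dom f = Dom h`, `Range f = Dom g`, `Range g = Range h` and
`h = g ∘ f`. -/
def IsCoherentTriple {M : Struc L A} (f g h : PartialAut M) : Prop :=
  f.dom.verts = h.dom.verts ∧ f.ran.verts = g.dom.verts ∧ g.ran.verts = h.ran.verts ∧
  ∀ (a : A) (hf : a ∈ f.dom.verts) (hg : (f.iso.toEquiv ⟨a, hf⟩ : A) ∈ g.dom.verts)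
    (hh : a ∈ h.dom.verts),
    (h.iso.toEquiv ⟨a, hh⟩ : A) = g.iso.toEquiv ⟨f.iso.toEquiv ⟨a, hf⟩, hg⟩

/-- The automorphism `θ` of `N` extends the partial automorphism `f` of `M`, where `M` is identified
with its image under the embedding `ψ`; i.e. `θ` extends `ψ ∘ f ∘ ψ⁻¹`. -/
def Extends {M : Struc L A} {N : Struc L B} (ψ : Embed M N) (θ : Aut N) (f : PartialAut M) : Prop :=
  ∀ a : f.dom.verts, θ.toEquiv (ψ.toFun a) = ψ.toFun (f.iso.toEquiv a)

/-- With respect to `ψ`, the structure `N` is a coherent EPPA-witness for `M`: one can choose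
for every partial automorphism of `ψ(M)` an automorphism of `N` extending it, in such a way that
coherent triples are sent to coherent triples (for everywhere defined maps, the latter says that the
third is the composition of the first two). -/
def IsCoherentEPPAWitness {M : Struc L A} {N : Struc L B} (ψ : Embed M N) : Prop :=
  ∃ φ : PartialAut M → Aut N,
    (∀ f, Extends ψ (φ f) f) ∧
    ∀ f g h, IsCoherentTriple f g h →
      ∀ b : B, (φ h).toEquiv b = (φ g).toEquiv ((φ f).toEquiv b)

/-- Every irreducible substructure of `N` is sent into `ψ(M)` by an automorphism of `N`. -/
def IsIrreducibleStructureFaithful {M : Struc L A} {N : Struc L B} (ψ : Embed M N) : Prop :=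
  ∀ C : Sub N, IsIrreducible C.struc →
    ∃ g : Aut N, ∀ c ∈ C.verts, g.toEquiv c ∈ Set.range ψ.toFun

/-- Irreducible structure faithful coherent EPPA for a class `K` of structures. -/
def HasIrreducibleStructureFaithfulCoherentEPPA
    (K : ∀ A : Type u, Struc L A → Prop) : Prop :=
  ∀ (A : Type u) (M : Struc L A), K A M →
    ∃ (B : Type u) (N : Struc L B), K B N ∧
      ∃ ψ : Embed M N, IsCoherentEPPAWitness ψ ∧ IsIrreducibleStructureFaithful ψ

end SetValued

namespace KOrientation

open SetValued

/-- The out-degree of a vertex. -/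
noncomputable def outDegree {V : Type u} (G : Digraph V) (x : V) : ℕ∞ := {y | G.Adj x y}.encard

/-- `k`-orientations: oriented graphs (no loops, no pair of opposite edges) in which every
vertex has out-degree at most `k`. -/
structure IsKOrientation {V : Type u} (k : ℕ) (G : Digraph V) : Prop where
  asymm : ∀ x y, G.Adj x y → ¬ G.Adj y x
  outDegree_le : ∀ x, outDegree G x ≤ k

/-- Roots: the vertices of out-degree less than `k`. -/
def IsRoot {V : Type u} (k : ℕ) (G : Digraph V) (x : V) : Prop := outDegree G x < k

/-- The relation symbols: a single binary symbol for the edges. -/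
inductive Rel : ℕ → Type
  | edge : Rel 2

/-- The function symbols of `L_s`: a single unary symbol. -/
inductive FunS : ℕ → Type
  | reach : FunS 1

/-- The function symbols of `L_d`: the unary symbol of `L_s`, and an `n`-ary symbol `F_n` for every
`n ≥ 1`. -/
inductive FunD : ℕ → Type
  | reach : FunD 1
  | rootClosure (n : ℕ) (hn : 1 ≤ n) : FunD n

/-- The language `L_s`. -/
def Ls : FirstOrder.Language.{0, 0} := ⟨FunS, Rel⟩

/-- The language `L_d`. -/
def Ld : FirstOrder.Language.{0, 0} := ⟨FunD, Rel⟩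

/-- The interpretation of the edge symbol. -/
def edgeRel {V : Type u} (G : Digraph V) : ∀ {n : ℕ}, Rel n → (Fin n → V) → Prop
  | _, .edge, x => G.Adj (x 0) (x 1)

/-- The set of vertices reachable from `x` by a directed path (possibly of length `0`). -/
def reachable {V : Type u} (G : Digraph V) (x : V) : Set V :=
  {y | Relation.ReflTransGen G.Adj x y}

/-- The interpretation of the function symbol of `L_s`: `F(x)` is the set of vertices reachable
from `x`. -/
def funcS {V : Type u} (G : Digraph V) : ∀ {n : ℕ}, FunS n → (Fin n → V) → Set V
  | _, .reach, x => reachable G (x 0)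

/-- The expansion `s(G)` of `G` to the language `L_s`. -/
def sStruc {V : Type u} (G : Digraph V) : Struc Ls V where
  func := funcS G
  rel := edgeRel G

/-- The set of all roots in the closure of `y` in `s(G)`. -/
def roots {V : Type u} (k : ℕ) (G : Digraph V) (y : V) : Set V :=
  {x | IsRoot k G x ∧ x ∈ closure (sStruc G) {y}}

/-- The interpretation of the function symbols of `L_d`: `F(x)` is the set of vertices reachable
from `x`, and `F_n(x₁, …, xₙ)` consists of the vertices `y` with `roots(y) = {x₁, …, xₙ}` if
`x₁, …, xₙ` are distinct roots, and is empty otherwise. -/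
def funcD {V : Type u} (k : ℕ) (G : Digraph V) : ∀ {n : ℕ}, FunD n → (Fin n → V) → Set V
  | _, .reach, x => reachable G (x 0)
  | _, .rootClosure _ _, x =>
    {y | (Function.Injective x ∧ ∀ i, IsRoot k G (x i)) ∧ roots k G y = Set.range x}

/-- The expansion `d(s(G))` of `s(G)` to the language `L_d`. -/
def dStruc {V : Type u} (k : ℕ) (G : Digraph V) : Struc Ld V where
  func := funcD k G
  rel := edgeRel G

/-- The class of all structures `d(s(G))`, where `G` is a finite `k`-orientation. -/
def ClassD (k : ℕ) (V : Type u) (M : Struc Ld V) : Prop :=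
  Finite V ∧ ∃ G : Digraph V, IsKOrientation k G ∧ M = dStruc k G

end KOrientation

/-! A substructure of `dStruc k G` is closed under out-neighbours and contains each vertex whose
root set is nonempty and lies inside it. The witness is a finite `k`-orientation `H` obtained from
`G` in three stages.

Stage one (`exists_witness_orbits`) ignores the functions `F_n`. Vertices are renamed copies of the
subgraphs generated by single vertices of `G`, with all permutations of the vertex set acting. A
partial automorphism extends to a permutation by matching the complements of its domain and range
rank by rank, which is coherent. Every vertex can be moved into the image of `G`, but that image may
fail to be closed under the `F_n`.

The other two stages replace vertices by vertices with a labelling of their reachable roots. Edges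
lift uniquely, so out-degrees and roots are unchanged. In `exists_witness_closed` the labels are
weights mod 2 with sum 1 at every vertex that reaches a root. The weights chosen on the copy of `G`
sum to 0 at vertices outside it, so no outside vertex has all its roots in the new copy. In
`exists_witness_faithful` the labels inject the roots below a vertex, for each set `X` that cannot
be moved into the copy of `G`, into `X` minus one point. By pigeonhole, a set of roots of which any
two lie below a common vertex cannot project onto such an `X`, and hence can be moved into the copy
of `G`.

Finally (`exists_map_into_of_isIrreducible`), any two roots of an irreducible substructure lie below
a common vertex. Once its roots are inside the copy of `G`, closedness brings in the vertices that
reach roots. A rootless irreducible substructure is generated by one vertex, and stage one deals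
with it. -/

/-! ### Coherent extension of partial bijections -/

theorem Set.exists_injOn_image_eq_Iio {K : Type u} [Finite K] (S : Set K) :
    ∃ e : K → ℕ, Set.InjOn e S ∧ e '' S = Set.Iio S.ncard := by
  classical
  have e : S ≃ Fin (Nat.card S) := Finite.equivFin S
  refine ⟨fun x => if h : x ∈ S then (e ⟨x, h⟩ : ℕ) else 0, ?_, ?_⟩
  · intro x hx y hy hxy
    simp only [hx, hy, dif_pos] at hxy
    simpa using e.injective (Fin.ext hxy)
  · ext n
    simp only [Set.mem_image, Set.mem_Iio]
    constructor
    · rintro ⟨x, hx, rfl⟩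
      simp only [hx, dif_pos]
      exact (e ⟨x, hx⟩).2
    · intro hn
      refine ⟨(e.symm ⟨n, hn⟩ : S), (e.symm ⟨n, hn⟩).2, ?_⟩
      simp only [Subtype.coe_prop, dif_pos, Subtype.coe_eta]
      exact congrArg Fin.val (e.apply_symm_apply ⟨n, hn⟩)

/-- Partial bijections of a finite set extend to permutations, compatibly with composition. -/
theorem Equiv.Perm.exists_coherent_extension (K : Type u) [Finite K] :
    ∃ E : Set K → Set K → (K → K) → Equiv.Perm K,
      (∀ D D' p, Set.BijOn p D D' → ∀ x ∈ D, E D D' p x = p x) ∧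
      (∀ D D' p, Set.BijOn p D D' → ∀ x, E D D' p x ∈ D' ↔ x ∈ D) ∧
      ∀ D D' D'' p q r, Set.BijOn p D D' → Set.BijOn q D' D'' → Set.BijOn r D D'' →
        (∀ x ∈ D, r x = q (p x)) → ∀ x, E D D'' r x = E D' D'' q (E D D' p x) := by
  classical
  choose e he he' using fun S : Set K => Set.exists_injOn_image_eq_Iio S
  have key : ∀ D D' p, ∃ σ : Equiv.Perm K, Set.BijOn p D D' →
      (∀ x ∈ D, σ x = p x) ∧ ∀ x ∉ D, σ x ∉ D' ∧ e D'ᶜ (σ x) = e Dᶜ x := by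
    intro D D' p
    by_cases hp : Set.BijOn p D D'
    swap
    · exact ⟨1, fun h => absurd h hp⟩
    have hcard : Dᶜ.ncard = D'ᶜ.ncard := by
      rw [Set.ncard_compl, Set.ncard_compl, ← hp.image_eq, hp.injOn.ncard_image]
    have h1 : ∀ x, ∃ y, (x ∈ D → y = p x) ∧ (x ∉ D → y ∉ D' ∧ e D'ᶜ y = e Dᶜ x) := by
      intro x
      by_cases hx : x ∈ D
      · exact ⟨p x, fun _ => rfl, fun h => absurd hx h⟩
      · have : e Dᶜ x ∈ e D'ᶜ '' D'ᶜ := by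
          rw [he', ← hcard, ← he']
          exact ⟨x, hx, rfl⟩
        obtain ⟨y, hy, hyx⟩ := this
        exact ⟨y, fun h => absurd h hx, fun _ => ⟨hy, hyx⟩⟩
    choose s hs hs' using h1
    have hinj : Function.Injective s := by
      intro x y hxy
      by_cases hx : x ∈ D <;> by_cases hy : y ∈ D
      · rw [hs x hx, hs y hy] at hxy
        exact hp.injOn hx hy hxy
      · refine absurd ?_ (hs' y hy).1
        rw [← hxy, hs x hx]
        exact hp.mapsTo hx
      · refine absurd ?_ (hs' x hx).1
        rw [hxy, hs y hy]
        exact hp.mapsTo hy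
      · apply he Dᶜ hx hy
        rw [← (hs' x hx).2, ← (hs' y hy).2, hxy]
    exact ⟨Equiv.ofBijective s (Finite.injective_iff_bijective.1 hinj),
      fun _ => ⟨fun x hx => hs x hx, fun x hx => hs' x hx⟩⟩
  choose E hE using key
  refine ⟨E, fun D D' p h => (hE D D' p h).1, ?_, ?_⟩
  · intro D D' p h x
    by_cases hx : x ∈ D
    · simp only [hx, iff_true]
      rw [(hE D D' p h).1 x hx]
      exact h.mapsTo hx
    · simpa only [hx, iff_false] using ((hE D D' p h).2 x hx).1
  · intro D D' D'' p q r hp hq hr hpq x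
    by_cases hx : x ∈ D
    · rw [(hE D D'' r hr).1 x hx, (hE D D' p hp).1 x hx,
        (hE D' D'' q hq).1 _ (hp.mapsTo hx), hpq x hx]
    · have h1 := (hE D D'' r hr).2 x hx
      have h2 := (hE D D' p hp).2 x hx
      have h3 := (hE D' D'' q hq).2 _ h2.1
      exact he D''ᶜ h1.1 h3.1 (by rw [h1.2, h3.2, h2.2])

/-! ### Closed sets and closed embeddings -/

namespace KOrientation

open SetValued Relation

variable {V : Type u} {W : Type v}

/-- The roots reachable from `y`. -/
def rootSet (k : ℕ) (G : Digraph V) (y : V) : Set V :=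
  {x | IsRoot k G x ∧ ReflTransGen G.Adj y x}

theorem closure_sStruc_singleton (G : Digraph V) (y : V) :
    SetValued.closure (sStruc G) {y} = reachable G y := by
  apply Set.Subset.antisymm
  · refine Set.iInter_subset_of_subset ⟨⟨reachable G y, ?_⟩, ?_⟩ subset_rfl
    · rintro n F x hx z hz
      cases (F : FunS n)
      exact ReflTransGen.trans (hx 0) hz
    · rintro _ rfl
      exact ReflTransGen.refl
  · rintro z hz
    refine Set.mem_iInter.2 fun S => ?_
    exact S.1.closed (n := 1) FunS.reach (fun _ => y) (fun _ => S.2 rfl) hz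

theorem roots_eq_rootSet (k : ℕ) (G : Digraph V) (y : V) : roots k G y = rootSet k G y := by
  simp only [roots, rootSet, closure_sStruc_singleton]
  rfl

theorem mem_rootSet_self {k : ℕ} {G : Digraph V} {r : V} (h : IsRoot k G r) :
    r ∈ rootSet k G r :=
  ⟨h, .refl⟩

theorem rootSet_mono {k : ℕ} {G : Digraph V} {x y : V} (h : ReflTransGen G.Adj x y) :
    rootSet k G y ⊆ rootSet k G x :=
  fun _ hr => ⟨hr.1, h.trans hr.2⟩

/-- Vertex sets of substructures of `dStruc k G`. -/
structure IsClosedSet (k : ℕ) (G : Digraph V) (S : Set V) : Prop where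
  mem_of_adj : ∀ {a b}, a ∈ S → G.Adj a b → b ∈ S
  mem_of_rootSet : ∀ {b}, (rootSet k G b).Nonempty → rootSet k G b ⊆ S → b ∈ S

theorem mem_of_reflTransGen {G : Digraph V} {S : Set V}
    (hS : ∀ {a b}, a ∈ S → G.Adj a b → b ∈ S) {a b : V} (ha : a ∈ S)
    (h : ReflTransGen G.Adj a b) : b ∈ S := by
  induction h with
  | refl => exact ha
  | tail _ h ih => exact hS ih h

theorem IsClosedSet.funcD_subset {k : ℕ} {G : Digraph V} {S : Set V} (hS : IsClosedSet k G S)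
    {n : ℕ} (F : FunD n) (x : Fin n → V) (hx : ∀ i, x i ∈ S) : funcD k G F x ⊆ S := by
  cases F with
  | reach => exact fun y hy => mem_of_reflTransGen hS.mem_of_adj (hx 0) hy
  | rootClosure n hn =>
    rintro y ⟨-, hy⟩
    rw [roots_eq_rootSet] at hy
    apply hS.mem_of_rootSet
    · rw [hy]
      exact ⟨_, ⟨0, hn⟩, rfl⟩
    · rw [hy]
      rintro _ ⟨i, rfl⟩
      exact hx i

/-- A nonempty finite root set can be listed as the argument tuple of some `F_n` with `n ≥ 1`.
Rootless vertices are in no value of any `F_n`, hence the nonemptiness condition. -/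
theorem isClosedSet_verts [Finite V] {k : ℕ} {G : Digraph V} (S : Sub (dStruc k G)) :
    IsClosedSet k G S.verts where
  mem_of_adj {a b} ha hab :=
    S.closed (n := 1) FunD.reach (fun _ => a) (fun _ => ha) (ReflTransGen.single hab)
  mem_of_rootSet {b} hb hbS := by
    let e := (Finite.equivFin (rootSet k G b)).symm
    have hn : 1 ≤ Nat.card (rootSet k G b) := by
      have := hb.to_subtype
      exact Nat.card_pos
    refine S.closed (FunD.rootClosure _ hn) (fun i => (e i : V)) (fun i => hbS (e i).2) ?_
    refine ⟨⟨Subtype.val_injective.comp e.injective, fun i => (e i).2.1⟩, ?_⟩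
    rw [roots_eq_rootSet]
    ext r
    constructor
    · intro hr
      exact ⟨e.symm ⟨r, hr⟩, congrArg Subtype.val (e.apply_symm_apply ⟨r, hr⟩)⟩
    · rintro ⟨i, rfl⟩
      exact (e i).2

/-- Isomorphisms onto induced subgraphs on successor-closed sets. -/
structure IsClosedEmb (G : Digraph V) (H : Digraph W) (j : V → W) : Prop where
  injective : Function.Injective j
  adj_iff : ∀ a b, H.Adj (j a) b ↔ ∃ a', G.Adj a a' ∧ j a' = b

theorem _root_.RelIso.isClosedEmb {G : Digraph V} {H : Digraph W} (θ : G.Adj ≃r H.Adj) :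
    IsClosedEmb G H θ where
  injective := θ.injective
  adj_iff a b := by
    constructor
    · intro h
      exact ⟨θ.symm b, by rw [← θ.map_rel_iff]; simpa using h, by simp⟩
    · rintro ⟨a', h, rfl⟩
      exact θ.map_rel_iff.2 h

namespace IsClosedEmb

variable {G : Digraph V} {H : Digraph W} {j : V → W} (hj : IsClosedEmb G H j)
include hj

theorem adj_map_iff (a b : V) : H.Adj (j a) (j b) ↔ G.Adj a b := by
  rw [hj.adj_iff]
  constructor
  · rintro ⟨a', h, hab⟩
    rwa [← hj.injective hab]
  · exact fun h => ⟨b, h, rfl⟩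

theorem outDegree_eq (a : V) : outDegree H (j a) = outDegree G a := by
  have : {y | H.Adj (j a) y} = j '' {y | G.Adj a y} := by
    ext y
    exact hj.adj_iff a y
  rw [outDegree, outDegree, this, hj.injective.encard_image]

theorem isRoot_iff (k : ℕ) (a : V) : IsRoot k H (j a) ↔ IsRoot k G a := by
  rw [IsRoot, IsRoot, hj.outDegree_eq]

theorem reflTransGen_iff (a : V) (b : W) :
    ReflTransGen H.Adj (j a) b ↔ ∃ a', ReflTransGen G.Adj a a' ∧ j a' = b := by
  constructor
  · intro h
    induction h with
    | refl => exact ⟨a, .refl, rfl⟩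
    | tail _ h ih =>
      obtain ⟨a', ha', rfl⟩ := ih
      obtain ⟨a'', h', rfl⟩ := (hj.adj_iff _ _).1 h
      exact ⟨a'', ha'.tail h', rfl⟩
  · rintro ⟨a', h, rfl⟩
    exact h.lift j fun a b hab => (hj.adj_map_iff a b).2 hab

theorem rootSet_eq (k : ℕ) (a : V) : rootSet k H (j a) = j '' rootSet k G a := by
  ext r
  constructor
  · rintro ⟨hr, h⟩
    obtain ⟨a', ha', rfl⟩ := (hj.reflTransGen_iff a r).1 h
    exact ⟨a', ⟨(hj.isRoot_iff k a').1 hr, ha'⟩, rfl⟩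
  · rintro ⟨a', ⟨hr, h⟩, rfl⟩
    exact ⟨(hj.isRoot_iff k a').2 hr, (hj.reflTransGen_iff a _).2 ⟨a', h, rfl⟩⟩

theorem mem_rootSet_iff (k : ℕ) (a r : V) : j r ∈ rootSet k H (j a) ↔ r ∈ rootSet k G a := by
  rw [hj.rootSet_eq, hj.injective.mem_set_image]

theorem edgeRel_iff {n : ℕ} (R : Rel n) (x : Fin n → V) :
    edgeRel G R x ↔ edgeRel H R (j ∘ x) := by
  cases R
  exact (hj.adj_map_iff _ _).symm

theorem isClosedSet_range {k : ℕ} (hr : ∀ b, (rootSet k H b).Nonempty →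
    rootSet k H b ⊆ Set.range j → b ∈ Set.range j) : IsClosedSet k H (Set.range j) where
  mem_of_adj := by
    rintro _ b ⟨a, rfl⟩ h
    obtain ⟨a', -, rfl⟩ := (hj.adj_iff _ _).1 h
    exact ⟨a', rfl⟩
  mem_of_rootSet h h' := hr _ h h'

/-- Root sets commute with `j`, which settles the values inside the range; closedness of the range
excludes further values. -/
theorem image_funcD {k : ℕ} (hr : IsClosedSet k H (Set.range j)) {n : ℕ} (F : FunD n)
    (x : Fin n → V) : j '' funcD k G F x = funcD k H F (j ∘ x) := by
  have hsub := hr.funcD_subset F (j ∘ x) fun i => ⟨x i, rfl⟩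
  have hmem : ∀ a, j a ∈ funcD k H F (j ∘ x) ↔ a ∈ funcD k G F x := by
    intro a
    cases F with
    | reach =>
      change ReflTransGen H.Adj (j (x 0)) (j a) ↔ ReflTransGen G.Adj (x 0) a
      rw [hj.reflTransGen_iff]
      constructor
      · rintro ⟨a', h, haa⟩
        rwa [← hj.injective haa]
      · exact fun h => ⟨a, h, rfl⟩
    | rootClosure n hn =>
      simp only [funcD, Set.mem_ofPred_eq, roots_eq_rootSet, hj.rootSet_eq, Set.range_comp,
        hj.injective.image_injective.eq_iff, Function.comp_apply, hj.isRoot_iff,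
        hj.injective.of_comp_iff]
  ext b
  constructor
  · rintro ⟨a, ha, rfl⟩
    exact (hmem a).2 ha
  · intro hb
    obtain ⟨a, rfl⟩ := hsub hb
    exact ⟨a, (hmem a).1 hb, rfl⟩

/-- A closed embedding with closed range is an embedding of the expansions. -/
def embed {k : ℕ} (hr : IsClosedSet k H (Set.range j)) : Embed (dStruc k G) (dStruc k H) where
  toFun := j
  injective := hj.injective
  map_rel R x := hj.edgeRel_iff R x
  map_func F x := hj.image_funcD hr F x

end IsClosedEmb

/-- Automorphisms of a digraph are automorphisms of its expansion. -/
def _root_.RelIso.aut {G : Digraph V} (k : ℕ) (θ : G.Adj ≃r G.Adj) : Aut (dStruc k G) where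
  toEquiv := θ.toEquiv
  map_rel R x := θ.isClosedEmb.edgeRel_iff R x
  map_func F x := θ.isClosedEmb.image_funcD (by
    refine θ.isClosedEmb.isClosedSet_range fun b _ _ => θ.surjective b) F x

theorem IsClosedSet.preimage {k : ℕ} {G : Digraph V} {S : Set V} (hS : IsClosedSet k G S)
    (θ : G.Adj ≃r G.Adj) : IsClosedSet k G (θ ⁻¹' S) where
  mem_of_adj ha hab := hS.mem_of_adj ha (θ.map_rel_iff.2 hab)
  mem_of_rootSet {b} hb hbS := by
    apply hS.mem_of_rootSet
    · rw [θ.isClosedEmb.rootSet_eq]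
      exact hb.image _
    · rw [θ.isClosedEmb.rootSet_eq]
      exact Set.image_subset_iff.2 hbS

/-! ### Renamed copies of generated subgraphs -/

/-- The edges of `D` reachable from `x`. -/
def genRel (D : V → V → Prop) (x : V) : V → V → Prop := fun a b => ReflTransGen D x a ∧ D a b

/-- The relation `D` with vertices renamed by `π`. -/
def mapRel (π : Equiv.Perm V) (D : V → V → Prop) : V → V → Prop :=
  fun a b => D (π.symm a) (π.symm b)

theorem reflTransGen_genRel {D : V → V → Prop} {x y z : V} (h : ReflTransGen D x y) :
    ReflTransGen (genRel D x) y z ↔ ReflTransGen D y z := by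
  constructor
  · exact fun h' => h'.lift id fun _ _ h => h.2
  · intro hz
    induction hz with
    | refl => exact .refl
    | tail h' h'' ih => exact ih.tail ⟨h.trans h', h''⟩

theorem genRel_genRel {D : V → V → Prop} {x y : V} (h : ReflTransGen D x y) :
    genRel (genRel D x) y = genRel D y := by
  ext a b
  rw [genRel, reflTransGen_genRel h]
  exact ⟨fun h' => ⟨h'.1, h'.2.2⟩, fun h' => ⟨h'.1, h.trans h'.1, h'.2⟩⟩

theorem reflTransGen_mapRel {D : V → V → Prop} (π : Equiv.Perm V) {x y : V} :
    ReflTransGen (mapRel π D) x y ↔ ReflTransGen D (π.symm x) (π.symm y) := by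
  constructor
  · exact fun h => h.lift π.symm fun _ _ h => h
  · intro h
    have := h.lift (p := mapRel π D) π fun a b h => by simpa [mapRel] using h
    simpa [Function.onFun] using this

theorem mapRel_genRel (π : Equiv.Perm V) (D : V → V → Prop) (x : V) :
    mapRel π (genRel D x) = genRel (mapRel π D) (π x) := by
  ext a b
  simp [mapRel, genRel, reflTransGen_mapRel]

theorem mapRel_symm_mapRel (π : Equiv.Perm V) (D : V → V → Prop) :
    mapRel π.symm (mapRel π D) = D := by
  ext a b
  simp [mapRel]

theorem mapRel_mapRel_symm (π : Equiv.Perm V) (D : V → V → Prop) :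
    mapRel π (mapRel π.symm D) = D := by
  ext a b
  simp [mapRel]

/-- The hypothesis on `π` allows `b` outside `S`, so `π a` acquires no out-neighbours beyond the
images of those of `a`. Paths therefore transfer in both directions. -/
theorem mapRel_genRel_eq {D : V → V → Prop} {S : Set V} (hS : ∀ {a b}, a ∈ S → D a b → b ∈ S)
    (π : Equiv.Perm V) (hπ : ∀ a ∈ S, ∀ b, D (π a) (π b) ↔ D a b) {a : V} (ha : a ∈ S) :
    mapRel π (genRel D a) = genRel D (π a) := by
  have h1 : ∀ b, ReflTransGen D a b → ReflTransGen D (π a) (π b) ∧ b ∈ S := by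
    intro b h
    induction h with
    | refl => exact ⟨.refl, ha⟩
    | tail _ h ih => exact ⟨ih.1.tail ((hπ _ ih.2 _).2 h), hS ih.2 h⟩
  have h2 : ∀ b, ReflTransGen D (π a) b → ReflTransGen D a (π.symm b) := by
    intro b h
    induction h with
    | refl => simpa using ReflTransGen.refl
    | @tail b c _ h ih =>
      refine ih.tail ((hπ _ (h1 _ ih).2 _).1 ?_)
      simpa using h
  ext b c
  constructor
  · rintro ⟨h, h'⟩
    have h3 := h1 _ h
    refine ⟨by simpa using h3.1, ?_⟩
    simpa using (hπ _ h3.2 _).2 h'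
  · rintro ⟨h, h'⟩
    have h3 := h2 _ h
    refine ⟨h3, (hπ _ (h1 _ h3).2 _).1 ?_⟩
    simpa using h'

/-- The pointed copies `(x, D)`, on the vertex set of `G`, of the subgraphs of `G` generated by a
vertex. -/
abbrev Copies (G : Digraph V) : Type u :=
  {p : V × (V → V → Prop) //
    ∃ (π : Equiv.Perm V) (a : V), p = (π a, mapRel π (genRel G.Adj a))}

namespace Copies

variable {G : Digraph V}

/-- There is an edge from `(x, D)` to `(y, D')` if `x → y` in `D` and `D'` is generated
by `y` in `D`. -/
def graph (G : Digraph V) : Digraph (Copies G) where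
  Adj p q := p.1.2 p.1.1 q.1.1 ∧ q.1.2 = genRel p.1.2 q.1.1

/-- Permutations of the vertices act on copies. -/
def perm (π : Equiv.Perm V) : (graph G).Adj ≃r (graph G).Adj where
  toFun p := ⟨(π p.1.1, mapRel π p.1.2), by
    obtain ⟨ρ, a, h⟩ := p.2
    exact ⟨π * ρ, a, by rw [h]; rfl⟩⟩
  invFun p := ⟨(π.symm p.1.1, mapRel π.symm p.1.2), by
    obtain ⟨ρ, a, h⟩ := p.2
    exact ⟨π.symm * ρ, a, by rw [h]; rfl⟩⟩
  left_inv p := by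
    apply Subtype.ext
    simp [mapRel_symm_mapRel]
  right_inv p := by
    apply Subtype.ext
    simp [mapRel_mapRel_symm]
  map_rel_iff' {p q} := by
    change mapRel π p.1.2 (π p.1.1) (π q.1.1) ∧ mapRel π q.1.2 = genRel (mapRel π p.1.2) (π q.1.1) ↔
      p.1.2 p.1.1 q.1.1 ∧ q.1.2 = genRel p.1.2 q.1.1
    rw [← mapRel_genRel]
    refine and_congr (by simp [mapRel]) ⟨fun h => ?_, fun h => by rw [h]⟩
    rw [← mapRel_symm_mapRel π q.1.2, h, mapRel_symm_mapRel]

/-- The canonical copy at a vertex. -/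
def of (G : Digraph V) (a : V) : Copies G := ⟨(a, genRel G.Adj a), 1, a, rfl⟩

theorem exists_perm_of (p : Copies G) : ∃ π a, p = perm π (of G a) := by
  obtain ⟨π, a, h⟩ := p.2
  exact ⟨π, a, Subtype.ext h⟩

/-- If `b` is reachable from `a`, it generates the same subgraph inside the subgraph generated by
`a` as in `G`. Out-neighbours of canonical copies are thus canonical. -/
theorem isClosedEmb_of : IsClosedEmb G (graph G) (of G) where
  injective a b h := congrArg (fun p : Copies G => p.1.1) h
  adj_iff a p := by
    constructor
    · rintro ⟨h, h'⟩
      refine ⟨p.1.1, h.2, Subtype.ext (Prod.ext rfl ?_)⟩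
      rw [h']
      exact (genRel_genRel (ReflTransGen.single h.2)).symm
    · rintro ⟨b, h, rfl⟩
      refine ⟨⟨.refl, h⟩, ?_⟩
      exact (genRel_genRel (ReflTransGen.single h)).symm

theorem perm_of {S : Set V} (hS : ∀ {a b}, a ∈ S → G.Adj a b → b ∈ S)
    (π : Equiv.Perm V) (hπ : ∀ a ∈ S, ∀ b, G.Adj (π a) (π b) ↔ G.Adj a b) {a : V} (ha : a ∈ S) :
    perm π (of G a) = of G (π a) :=
  Subtype.ext (Prod.ext rfl (mapRel_genRel_eq hS π hπ ha))

/-- Each vertex is a translate of a canonical copy, whose out-neighbourhood is that of a vertex of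
`G`. -/
theorem isKOrientation {k : ℕ} (hG : IsKOrientation k G) : IsKOrientation k (graph G) where
  asymm p q hpq hqp := by
    obtain ⟨π, a, rfl⟩ := exists_perm_of p
    obtain ⟨p, rfl⟩ := (perm π).surjective q
    rw [(perm π).map_rel_iff] at hpq hqp
    obtain ⟨b, h, rfl⟩ := (isClosedEmb_of.adj_iff _ _).1 hpq
    rw [isClosedEmb_of.adj_map_iff] at hqp
    exact hG.asymm _ _ h hqp
  outDegree_le p := by
    obtain ⟨π, a, rfl⟩ := exists_perm_of p
    rw [(perm π).isClosedEmb.outDegree_eq, isClosedEmb_of.outDegree_eq]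
    exact hG.outDegree_le a

end Copies

/-! ### Witnesses and the first stage -/

/-- A digraph containing `G` to which all partial automorphisms of the expansion of `G` extend
coherently. -/
structure Witness (k : ℕ) (G : Digraph V) (H : Digraph W) where
  /-- the embedding -/
  emb : V → W
  isClosedEmb : IsClosedEmb G H emb
  /-- the extension of a partial automorphism -/
  ext : PartialAut (dStruc k G) → (H.Adj ≃r H.Adj)
  ext_emb : ∀ (f : PartialAut (dStruc k G)) (a : f.dom.verts),
    ext f (emb a) = emb (f.iso.toEquiv a)
  coherent : ∀ f g h, IsCoherentTriple f g h → ∀ b, ext h b = ext g (ext f b)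

theorem Witness.ext_mem_iff {k : ℕ} {G : Digraph V} {H : Digraph W} (w : Witness k G H)
    (f : PartialAut (dStruc k G)) (b : W) :
    w.ext f b ∈ w.emb '' f.ran.verts ↔ b ∈ w.emb '' f.dom.verts := by
  constructor
  · rintro ⟨t, ht, h⟩
    obtain ⟨a, ha⟩ := f.iso.toEquiv.surjective ⟨t, ht⟩
    refine ⟨a, a.2, (w.ext f).injective ?_⟩
    rw [w.ext_emb, ha, h]
  · rintro ⟨a, ha, rfl⟩
    rw [w.ext_emb f ⟨a, ha⟩]
    exact ⟨_, Subtype.coe_prop _, rfl⟩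

open Classical in
/-- A partial automorphism, as a total map. -/
noncomputable def PartialAut.total {G : Digraph V} {k : ℕ} (f : PartialAut (dStruc k G)) (a : V) :
    V :=
  if h : a ∈ f.dom.verts then f.iso.toEquiv ⟨a, h⟩ else a

namespace PartialAut

variable {G : Digraph V} {k : ℕ} (f : PartialAut (dStruc k G))

theorem total_apply (a : f.dom.verts) : total f a = f.iso.toEquiv a := by
  rw [total, dif_pos a.2]

theorem bijOn : Set.BijOn (total f) f.dom.verts f.ran.verts := by
  refine ⟨fun a ha => ?_, fun a ha b hb h => ?_, fun b hb => ?_⟩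
  · rw [total_apply f ⟨a, ha⟩]
    exact (f.iso.toEquiv ⟨a, ha⟩).2
  · rw [total_apply f ⟨a, ha⟩, total_apply f ⟨b, hb⟩] at h
    exact congrArg Subtype.val (f.iso.toEquiv.injective (Subtype.ext h))
  · refine ⟨f.iso.toEquiv.symm ⟨b, hb⟩, Subtype.coe_prop _, ?_⟩
    rw [total_apply]
    simp

theorem adj_total {a b : V} (ha : a ∈ f.dom.verts) (hb : b ∈ f.dom.verts) :
    G.Adj (total f a) (total f b) ↔ G.Adj a b := by
  rw [total_apply f ⟨a, ha⟩, total_apply f ⟨b, hb⟩]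
  exact (f.iso.map_rel (n := 2) Rel.edge ![⟨a, ha⟩, ⟨b, hb⟩]).symm

theorem total_comp {f g h : PartialAut (dStruc k G)} (H : IsCoherentTriple f g h) {a : V}
    (ha : a ∈ f.dom.verts) : total h a = total g (total f a) := by
  have hg : total f a ∈ g.dom.verts := H.2.1 ▸ (bijOn f).mapsTo ha
  have hh : a ∈ h.dom.verts := H.1 ▸ ha
  have := total_apply f ⟨a, ha⟩
  rw [total_apply h ⟨a, hh⟩, total_apply g ⟨_, hg⟩]
  rw [H.2.2.2 a ha (this ▸ hg) hh]
  simp only [this]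

end PartialAut

theorem exists_witness_orbits [Finite V] {k : ℕ} {G : Digraph V} (hG : IsKOrientation k G) :
    ∃ (W : Type u) (_ : Finite W) (H : Digraph W), IsKOrientation k H ∧
      ∃ w : Witness k G H, ∀ b, ∃ θ : H.Adj ≃r H.Adj, θ b ∈ Set.range w.emb := by
  obtain ⟨E, h1, h2, h3⟩ := Equiv.Perm.exists_coherent_extension V
  refine ⟨Copies G, inferInstance, Copies.graph G, Copies.isKOrientation hG,
    { emb := Copies.of G
      isClosedEmb := Copies.isClosedEmb_of
      ext := fun f => Copies.perm (E f.dom.verts f.ran.verts (PartialAut.total f))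
      ext_emb := ?_
      coherent := ?_ }, ?_⟩
  · intro f a
    have hb := PartialAut.bijOn f
    rw [Copies.perm_of (isClosedSet_verts f.dom).mem_of_adj _ _ a.2, h1 _ _ _ hb a a.2,
      PartialAut.total_apply]
    intro a ha b
    by_cases hbd : b ∈ f.dom.verts
    · rw [h1 _ _ _ hb a ha, h1 _ _ _ hb b hbd, PartialAut.adj_total f ha hbd]
    -- The extension maps the complement of the domain into the complement of the range, and both
    -- domain and range are closed under out-neighbours. So neither edge exists.
    · refine iff_of_false (fun h => hbd ?_)
        fun h => hbd ((isClosedSet_verts f.dom).mem_of_adj ha h)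
      rw [← h2 _ _ _ hb]
      exact (isClosedSet_verts f.ran).mem_of_adj ((h2 _ _ _ hb a).2 ha) h
  · intro f g h H p
    have h4 : ∀ x, E h.dom.verts h.ran.verts (PartialAut.total h) x =
        E g.dom.verts g.ran.verts (PartialAut.total g)
          (E f.dom.verts f.ran.verts (PartialAut.total f) x) := by
      have hf := PartialAut.bijOn f
      have hg := PartialAut.bijOn g
      have hh := PartialAut.bijOn h
      rw [← H.1, ← H.2.2.1, ← H.2.1] at *
      exact h3 _ _ _ _ _ _ hf hg hh fun x hx => PartialAut.total_comp H hx
    have h5 : E h.dom.verts h.ran.verts (PartialAut.total h) =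
        E g.dom.verts g.ran.verts (PartialAut.total g) *
          E f.dom.verts f.ran.verts (PartialAut.total f) := Equiv.ext h4
    rw [h5]
    rfl
  · intro b
    obtain ⟨π, a, rfl⟩ := Copies.exists_perm_of b
    exact ⟨(Copies.perm π).symm, a, by simp⟩

/-! ### Lifting by labellings of roots -/

/-- A condition on labellings of the roots reachable from a vertex. -/
structure LabelCond (k : ℕ) (H : Digraph W) (Λ : Type v) where
  /-- the labelling is admissible at a vertex -/
  Good : W → (W → Λ) → Prop
  congr : ∀ {z l l'}, (∀ r ∈ rootSet k H z, l r = l' r) → Good z l → Good z l'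

namespace LabelCond

variable {k : ℕ} {H : Digraph W} {Λ : Type v} [Inhabited Λ] (C : LabelCond k H Λ)

open Classical in
/-- The restriction of a labelling to the roots reachable from `u`. -/
noncomputable def cut (k : ℕ) (H : Digraph W) (u : W) (l : W → Λ) (r : W) : Λ :=
  if r ∈ rootSet k H u then l r else default

theorem cut_of_mem {u r : W} (h : r ∈ rootSet k H u) (l : W → Λ) : cut k H u l r = l r :=
  if_pos h

theorem cut_of_notMem {u r : W} (h : r ∉ rootSet k H u) (l : W → Λ) :
    cut k H u l r = default :=
  if_neg h

/-- Vertices together with a labelling of the reachable roots, admissible at all reachable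
vertices. -/
abbrev Lift : Type v :=
  {p : W × (W → Λ) // (∀ r ∉ rootSet k H p.1, p.2 r = default) ∧
    ∀ z, ReflTransGen H.Adj p.1 z → C.Good z p.2}

variable {C}

/-- Labels off the reachable roots are fixed to `default`, so they carry no information. -/
theorem Lift.ext' {p q : C.Lift} (h : p.1.1 = q.1.1)
    (h' : ∀ r ∈ rootSet k H p.1.1, p.1.2 r = q.1.2 r) : p = q := by
  refine Subtype.ext (Prod.ext h (funext fun r => ?_))
  by_cases hr : r ∈ rootSet k H p.1.1
  · exact h' r hr
  · rw [p.2.1 r hr, q.2.1 r (h ▸ hr)]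

/-- The vertex `u` with the restriction of the labelling `l`. -/
noncomputable def Lift.mk (u : W) (l : W → Λ)
    (hl : ∀ z, ReflTransGen H.Adj u z → C.Good z l) : C.Lift :=
  ⟨(u, cut k H u l), fun _ hr => cut_of_notMem hr l,
    fun z hz => C.congr (fun _ hr => (cut_of_mem (rootSet_mono hz hr) l).symm) (hl z hz)⟩

theorem Lift.mk_label {u : W} {l : W → Λ} {hl : ∀ z, ReflTransGen H.Adj u z → C.Good z l} {r : W}
    (hr : r ∈ rootSet k H u) : (Lift.mk (C := C) u l hl).1.2 r = l r :=
  cut_of_mem hr l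

/-- The restriction of the labelling at `p` to the vertex `u`. -/
noncomputable def Lift.restrict (p : C.Lift) (u : W) (h : ReflTransGen H.Adj p.1.1 u) : C.Lift :=
  Lift.mk u p.1.2 fun z hz => p.2.2 z (h.trans hz)

variable (C) in
/-- The digraph on labelled vertices. -/
def graph : Digraph C.Lift where
  Adj p q := H.Adj p.1.1 q.1.1 ∧ ∀ r ∈ rootSet k H q.1.1, q.1.2 r = p.1.2 r

theorem adj_iff {p q : C.Lift} :
    C.graph.Adj p q ↔ ∃ h : H.Adj p.1.1 q.1.1, q = p.restrict q.1.1 (.single h) := by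
  constructor
  · rintro ⟨h, h'⟩
    exact ⟨h, Lift.ext' rfl fun r hr => by rw [h' r hr, Lift.restrict, Lift.mk_label hr]⟩
  · rintro ⟨h, h'⟩
    refine ⟨h, fun r hr => ?_⟩
    rw [h', Lift.restrict, Lift.mk_label hr]

theorem reflTransGen_iff {p q : C.Lift} :
    ReflTransGen C.graph.Adj p q ↔
      ReflTransGen H.Adj p.1.1 q.1.1 ∧ ∀ r ∈ rootSet k H q.1.1, q.1.2 r = p.1.2 r := by
  constructor
  · intro h
    induction h with
    | refl => exact ⟨.refl, fun _ _ => rfl⟩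
    | @tail q s _ h ih =>
      refine ⟨ih.1.tail h.1, fun r hr => ?_⟩
      rw [h.2 r hr, ih.2 r (rootSet_mono (.single h.1) hr)]
  · rintro ⟨h, h'⟩
    have key : ∀ u (hu : ReflTransGen H.Adj p.1.1 u),
        ReflTransGen C.graph.Adj p (p.restrict u hu) := by
      intro u hu
      induction hu with
      | refl =>
        have : p.restrict p.1.1 .refl = p := Lift.ext' rfl fun r hr => Lift.mk_label hr
        rw [this]
      | @tail u v hu huv ih =>
        refine ih.tail ⟨huv, fun r hr => ?_⟩
        rw [Lift.restrict, Lift.restrict]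
        exact (Lift.mk_label (C := C) hr).trans
          (Lift.mk_label (C := C) (rootSet_mono (.single huv) hr)).symm
    have : q = p.restrict q.1.1 h := Lift.ext' rfl fun r hr => by
      rw [h' r hr, Lift.restrict, Lift.mk_label hr]
    rw [this]
    exact key _ _

/-- An edge downstairs has exactly one lift starting at `p`, since the label at its end must be the
restriction of the label at `p`. -/
theorem outDegree_graph (p : C.Lift) : outDegree C.graph p = outDegree H p.1.1 := by
  have h1 : {u | H.Adj p.1.1 u} = (fun q : C.Lift => q.1.1) '' {q | C.graph.Adj p q} := by
    ext u
    constructor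
    · intro hu
      exact ⟨p.restrict u (.single hu), adj_iff.2 ⟨hu, rfl⟩, rfl⟩
    · rintro ⟨q, hq, rfl⟩
      exact hq.1
  rw [outDegree, outDegree, h1, Set.InjOn.encard_image]
  intro q hq q' hq' (h : q.1.1 = q'.1.1)
  refine Lift.ext' h fun r hr => ?_
  rw [hq.2 r hr, hq'.2 r (h ▸ hr)]

theorem isRoot_graph (p : C.Lift) : IsRoot k C.graph p ↔ IsRoot k H p.1.1 := by
  rw [IsRoot, IsRoot, outDegree_graph]

theorem mem_rootSet_graph {p q : C.Lift} : q ∈ rootSet k C.graph p ↔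
    q.1.1 ∈ rootSet k H p.1.1 ∧ ∀ r ∈ rootSet k H q.1.1, q.1.2 r = p.1.2 r := by
  change IsRoot k C.graph q ∧ ReflTransGen C.graph.Adj p q ↔
    (IsRoot k H q.1.1 ∧ ReflTransGen H.Adj p.1.1 q.1.1) ∧ _
  rw [isRoot_graph, reflTransGen_iff, and_assoc]

theorem restrict_mem_rootSet (p : C.Lift) {r : W} (hr : r ∈ rootSet k H p.1.1) :
    p.restrict r hr.2 ∈ rootSet k C.graph p :=
  mem_rootSet_graph.2 ⟨hr, fun _ hs => Lift.mk_label hs⟩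

theorem isKOrientation_graph (hH : IsKOrientation k H) : IsKOrientation k C.graph where
  asymm p q h h' := hH.asymm _ _ h.1 h'.1
  outDegree_le p := by
    rw [outDegree_graph]
    exact hH.outDegree_le _

/-- Lifting an automorphism, together with a relabelling at each root. -/
theorem exists_liftIso [Finite W] [Finite Λ] (θ : H.Adj ≃r H.Adj) (σ : W → Λ → Λ)
    (hσ : ∀ r, Function.Injective (σ r))
    (hg : ∀ z l, C.Good z l → C.Good (θ z) fun r => σ (θ.symm r) (l (θ.symm r))) :
    ∃ Θ : C.graph.Adj ≃r C.graph.Adj, ∀ p, (Θ p).1.1 = θ p.1.1 ∧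
      ∀ r ∈ rootSet k H p.1.1, (Θ p).1.2 (θ r) = σ r (p.1.2 r) := by
  let T : C.Lift → C.Lift := fun p =>
    Lift.mk (θ p.1.1) (fun r => σ (θ.symm r) (p.1.2 (θ.symm r))) fun z hz => by
      obtain ⟨z, hz', rfl⟩ := (θ.isClosedEmb.reflTransGen_iff _ _).1 hz
      exact hg z _ (p.2.2 z hz')
  have hT : ∀ p, ∀ r ∈ rootSet k H p.1.1, (T p).1.2 (θ r) = σ r (p.1.2 r) := by
    intro p r hr
    refine (Lift.mk_label ((θ.isClosedEmb.mem_rootSet_iff k _ _).2 hr)).trans ?_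
    simp
  have hinj : Function.Injective T := by
    intro p q hpq
    have h1 : p.1.1 = q.1.1 := θ.injective (congrArg (fun p : C.Lift => p.1.1) hpq)
    refine Lift.ext' h1 fun r hr => hσ r ?_
    rw [← hT p r hr, ← hT q r (h1 ▸ hr), hpq]
  refine ⟨⟨Equiv.ofBijective T (Finite.injective_iff_bijective.1 hinj), ?_⟩,
    fun p => ⟨rfl, hT p⟩⟩
  intro p q
  change H.Adj (θ p.1.1) (θ q.1.1) ∧ (∀ r ∈ rootSet k H (θ q.1.1), (T q).1.2 r = (T p).1.2 r) ↔
    H.Adj p.1.1 q.1.1 ∧ ∀ r ∈ rootSet k H q.1.1, q.1.2 r = p.1.2 r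
  rw [θ.map_rel_iff, θ.isClosedEmb.rootSet_eq, Set.forall_mem_image]
  refine and_congr_right fun h => forall₂_congr fun r hr => ?_
  rw [hT q r hr, hT p r (rootSet_mono (.single h) hr), (hσ r).eq_iff]

section LiftSection

variable {G : Digraph V} {j : V → W} (hj : IsClosedEmb G H j)
  {l : W → Λ} (hl : ∀ a, C.Good (j a) l)

/-- The lift of an embedding by means of a labelling of all vertices. -/
noncomputable def liftSection (a : V) : C.Lift :=
  Lift.mk (j a) l fun z hz => by
    obtain ⟨b, -, rfl⟩ := (hj.reflTransGen_iff a z).1 hz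
    exact hl b

theorem liftSection_fst (a : V) : (liftSection hj hl a).1.1 = j a := rfl

theorem liftSection_label {a : V} {r : W} (hr : r ∈ rootSet k H (j a)) :
    (liftSection hj hl a).1.2 r = l r :=
  Lift.mk_label hr

theorem mem_range_liftSection {p : C.Lift} : p ∈ Set.range (liftSection hj hl) ↔
    p.1.1 ∈ Set.range j ∧ ∀ r ∈ rootSet k H p.1.1, p.1.2 r = l r := by
  constructor
  · rintro ⟨a, rfl⟩
    exact ⟨⟨a, rfl⟩, fun r hr => liftSection_label hj hl hr⟩
  · rintro ⟨⟨a, ha⟩, h⟩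
    refine ⟨a, Lift.ext' ha fun r hr => ?_⟩
    rw [liftSection_label hj hl hr, h r (ha ▸ hr)]

theorem isClosedEmb_liftSection : IsClosedEmb G C.graph (liftSection hj hl) where
  injective a b h := hj.injective (congrArg (fun p : C.Lift => p.1.1) h)
  adj_iff a p := by
    constructor
    · rintro ⟨h, h'⟩
      obtain ⟨b, hab, hb⟩ := (hj.adj_iff _ _).1 h
      refine ⟨b, hab, Lift.ext' hb fun r hr => ?_⟩
      rw [liftSection_label hj hl hr, h' r (hb ▸ hr),
        liftSection_label hj hl (rootSet_mono (.single h) (hb ▸ hr))]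
    · rintro ⟨b, hab, rfl⟩
      have h : H.Adj (j a) (j b) := (hj.adj_map_iff _ _).2 hab
      refine ⟨h, fun r hr => ?_⟩
      rw [liftSection_label hj hl hr, liftSection_label hj hl (rootSet_mono (.single h) hr)]

/-- The range of a section is closed if `l` is only admissible at the vertices of `G`. -/
theorem isClosedSet_range_liftSection (h : ∀ u, (rootSet k H u).Nonempty →
    rootSet k H u ⊆ Set.range j → C.Good u l → u ∈ Set.range j) :
    IsClosedSet k C.graph (Set.range (liftSection hj hl)) := by
  refine (isClosedEmb_liftSection hj hl).isClosedSet_range fun p hp hpr => ?_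
  -- The label of `p` at `r` can be read off from the restriction of `p` to `r`, which is a root of
  -- `p` and hence in the section. So `l` itself is admissible at the projection of `p`.
  have h1 : ∀ r ∈ rootSet k H p.1.1, r ∈ Set.range j ∧ p.1.2 r = l r := by
    intro r hr
    obtain ⟨h2, h3⟩ := (mem_range_liftSection hj hl).1 (hpr (restrict_mem_rootSet p hr))
    refine ⟨h2, ?_⟩
    rw [← h3 r (mem_rootSet_self hr.1)]
    exact (Lift.mk_label (C := C) (mem_rootSet_self hr.1)).symm
  refine (mem_range_liftSection hj hl).2 ⟨h _ ?_ (fun r hr => (h1 r hr).1) ?_, fun r hr => (h1 r hr).2⟩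
  · obtain ⟨q, hq⟩ := hp
    exact ⟨_, (mem_rootSet_graph.1 hq).1⟩
  · exact C.congr (fun r hr => (h1 r hr).2) (p.2.2 _ .refl)

end LiftSection

/-- Lifting a witness by means of a coherent family of relabellings. -/
theorem exists_witness [Finite W] [Finite Λ] {G : Digraph V} (w : Witness k G H) {l : W → Λ}
    (hl : ∀ a, C.Good (w.emb a) l) (σ : PartialAut (dStruc k G) → W → Λ → Λ)
    (hσ : ∀ f r, Function.Injective (σ f r))
    (hg : ∀ f z m, C.Good z m →
      C.Good (w.ext f z) fun r => σ f ((w.ext f).symm r) (m ((w.ext f).symm r)))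
    (hσl : ∀ (f : PartialAut (dStruc k G)), ∀ a ∈ f.dom.verts,
      σ f (w.emb a) (l (w.emb a)) = l (w.ext f (w.emb a)))
    (hcoh : ∀ f g h, IsCoherentTriple f g h → ∀ r x, σ h r x = σ g (w.ext f r) (σ f r x)) :
    ∃ w' : Witness k G C.graph, w'.emb = liftSection w.isClosedEmb hl := by
  choose Θ hΘ hΘ' using fun f => exists_liftIso (C := C) (w.ext f) (σ f) (hσ f) (hg f)
  refine ⟨⟨_, isClosedEmb_liftSection w.isClosedEmb hl, Θ, ?_, ?_⟩, rfl⟩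
  · intro f a
    refine Lift.ext' ?_ ?_
    · rw [hΘ, liftSection_fst, liftSection_fst, w.ext_emb]
    · rw [hΘ, liftSection_fst, (w.ext f).isClosedEmb.rootSet_eq, Set.forall_mem_image]
      intro r hr
      have hr' := (w.ext f).isClosedEmb.mem_rootSet_iff k _ _ |>.2 hr
      rw [w.ext_emb] at hr'
      rw [hΘ' f _ r hr, liftSection_label _ _ hr, liftSection_label _ _ hr']
      -- Roots reachable from the domain of `f` are in that domain, where `hσl` applies.
      obtain ⟨b, hb, rfl⟩ := (w.isClosedEmb.reflTransGen_iff _ _).1 hr.2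
      refine hσl f b ?_
      have h1 : b ∈ (_ : Set V) := f.dom.closed (n := 1) FunD.reach (fun _ => a)
        (fun _ => a.2) hb
      exact h1
  · intro f g h H p
    have h1 : (Θ h p).1.1 = (Θ g (Θ f p)).1.1 := by
      rw [hΘ, hΘ, hΘ, w.coherent f g h H]
    refine Lift.ext' h1 ?_
    rw [hΘ, (w.ext h).isClosedEmb.rootSet_eq, Set.forall_mem_image]
    intro r hr
    rw [hΘ' h _ r hr, w.coherent f g h H, hΘ' g, hΘ' f _ r hr, hcoh f g h H]
    rw [hΘ, (w.ext f).isClosedEmb.mem_rootSet_iff]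
    exact hr

end LabelCond

/-! ### Parity labels: making the image closed -/

section Parity

variable (k : ℕ) (H : Digraph W)

open Classical in
/-- The total weight of `z` at the roots reachable from `z`. -/
noncomputable def total [Fintype W] (m : W → W → ZMod 2) (z : W) : ZMod 2 :=
  ∑ r : W, if r ∈ rootSet k H z then m r z else 0

variable {k H}

theorem total_congr [Fintype W] {m m' : W → W → ZMod 2} {z : W}
    (h : ∀ r ∈ rootSet k H z, m r z = m' r z) : total k H m z = total k H m' z := by
  classical
  refine Finset.sum_congr rfl fun r _ => ?_
  by_cases hr : r ∈ rootSet k H z <;> simp [hr, h]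

theorem total_add [Fintype W] (m m' : W → W → ZMod 2) (z : W) :
    total k H (fun r z => m r z + m' r z) z = total k H m z + total k H m' z := by
  classical
  rw [total, total, total, ← Finset.sum_add_distrib]
  refine Finset.sum_congr rfl fun r _ => ?_
  by_cases hr : r ∈ rootSet k H z <;> simp [hr]

theorem total_map [Fintype W] (θ : H.Adj ≃r H.Adj) (m : W → W → ZMod 2) (z : W) :
    total k H (fun r z => m (θ.symm r) (θ.symm z)) (θ z) = total k H m z := by
  classical
  rw [total, total, ← θ.toEquiv.sum_comp]
  refine Finset.sum_congr rfl fun r _ => ?_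
  simp [θ.isClosedEmb.mem_rootSet_iff]

theorem total_eq_zero [Fintype W] {z : W} (h : rootSet k H z = ∅) (m : W → W → ZMod 2) :
    total k H m z = 0 := by
  classical
  simp [total, h]

open Classical in
theorem total_update [Fintype W] {z r : W} (hr : r ∈ rootSet k H z) (m : W → W → ZMod 2)
    (c : W → ZMod 2) (s : W → W) (hs : s z = r) :
    total k H (fun r z => m r z + if r = s z then c z else 0) z = total k H m z + c z := by
  classical
  rw [total_add (k := k) (H := H) m (fun r z => if r = s z then c z else 0)]
  congr 1
  rw [total, Finset.sum_eq_single r]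
  · simp [hr, hs]
  · intro b _ hb
    simp [hs, hb]
  · simp

/-- Weights with prescribed totals. -/
theorem exists_weight [Fintype W] (k : ℕ) (H : Digraph W) (c : W → ZMod 2) :
    ∃ m : W → W → ZMod 2, ∀ z, (rootSet k H z).Nonempty → total k H m z = c z := by
  classical
  have : ∀ z, ∃ r, (rootSet k H z).Nonempty → r ∈ rootSet k H z := fun z => by
    by_cases h : (rootSet k H z).Nonempty
    · exact ⟨h.some, fun _ => h.some_mem⟩
    · exact ⟨z, fun h' => absurd h' h⟩
  choose s hs using this
  -- The whole prescribed total is put on one chosen root `s z`; the `0 +` matches the shape of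
  -- `total_update`.
  refine ⟨fun r z => 0 + if r = s z then c z else 0, fun z hz => ?_⟩
  rw [total_update (hs z hz) (fun _ _ => 0) c s rfl]
  simp [total]

/-- A weight can be modified outside of `S` to have total `0` wherever possible. -/
theorem exists_weight_extending [Fintype W] (k : ℕ) (H : Digraph W) (m : W → W → ZMod 2)
    (S : Set W) : ∃ m' : W → W → ZMod 2, (∀ r ∈ S, ∀ z, m' r z = m r z) ∧
      ∀ z, ¬ rootSet k H z ⊆ S → total k H m' z = 0 := by
  classical
  have : ∀ z, ∃ r, ¬ rootSet k H z ⊆ S → r ∈ rootSet k H z ∧ r ∉ S := fun z => by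
    by_cases h : rootSet k H z ⊆ S
    · exact ⟨z, fun h' => absurd h h'⟩
    · obtain ⟨r, hr⟩ := Set.not_subset.1 h
      exact ⟨r, fun _ => hr⟩
  choose s hs using this
  -- Adding the old total at a single root outside `S` makes the new total zero, as the
  -- characteristic is two.
  refine ⟨fun r z => m r z + if r = s z then (if rootSet k H z ⊆ S then 0 else total k H m z)
    else 0, fun r hr z => ?_, fun z hz => ?_⟩
  · by_cases hz : rootSet k H z ⊆ S
    · simp [hz]
    · have : r ≠ s z := fun h => (hs z hz).2 (h ▸ hr)
      simp [this]
  · rw [total_update (hs z hz).1 m (fun z => if rootSet k H z ⊆ S then 0 else total k H m z) s rfl]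
    simp [hz, CharTwo.add_self_eq_zero]

/-- Labels are weights, which have to be of total weight `1`. -/
noncomputable def parityCond [Fintype W] (k : ℕ) (H : Digraph W) :
    LabelCond k H (W → ZMod 2) where
  Good z m := (rootSet k H z).Nonempty → total k H m z = 1
  congr {z l l'} h hg hz := by
    rw [← hg hz]
    exact total_congr fun r hr => congrFun (h r hr).symm z

/-- The relabelling along `θ` which shifts by two weights. -/
def shift (θ : H.Adj ≃r H.Adj) (m m' : W → W → ZMod 2) (r : W) (x : W → ZMod 2) : W → ZMod 2 :=
  fun z => x (θ.symm z) + (m r (θ.symm z) + m' (θ r) z)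

theorem shift_injective (θ : H.Adj ≃r H.Adj) (m m' : W → W → ZMod 2) (r : W) :
    Function.Injective (shift θ m m' r) := by
  intro x y h
  funext z
  have := congrFun h (θ z)
  simpa [shift] using this

/-- The shift changes the total at `θ z` by the sum of two equal totals, which vanishes mod 2. -/
theorem parityCond_shift [Fintype W] (θ : H.Adj ≃r H.Adj) {m m' : W → W → ZMod 2}
    (h : ∀ z, total k H m' (θ z) = total k H m z) (z : W) (x : W → W → ZMod 2)
    (hx : (parityCond k H).Good z x) :
    (parityCond k H).Good (θ z) fun r => shift θ m m' (θ.symm r) (x (θ.symm r)) := by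
  intro hz
  have hz' : (rootSet k H z).Nonempty := by
    rw [θ.isClosedEmb.rootSet_eq] at hz
    exact hz.of_image
  have h1 : (fun r => shift θ m m' (θ.symm r) (x (θ.symm r))) = fun r z =>
      (fun r z => x (θ.symm r) (θ.symm z)) r z +
        (fun r z => (fun r z => m (θ.symm r) (θ.symm z)) r z + m' r z) r z := by
    funext r z
    simp [shift]
  rw [h1, total_add, total_add, total_map, total_map, h, hx hz', CharTwo.add_self_eq_zero,
    add_zero]

end Parity

/-- A vertex outside the image with all roots in the section would need total 1, but the section
weights give it total 0. The clause on rootless vertices is kept because the `F_n`, and hence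
closedness, do not see them. -/
theorem exists_witness_closed [Finite V] {k : ℕ} {G : Digraph V} (hG : IsKOrientation k G) :
    ∃ (W : Type u) (_ : Finite W) (H : Digraph W), IsKOrientation k H ∧
      ∃ w : Witness k G H, IsClosedSet k H (Set.range w.emb) ∧
        ∀ b, rootSet k H b = ∅ → ∃ θ : H.Adj ≃r H.Adj, θ b ∈ Set.range w.emb := by
  classical
  obtain ⟨W, hW, H, hH, w, hw⟩ := exists_witness_orbits hG
  have : Fintype W := Fintype.ofFinite W
  obtain ⟨m, hm⟩ := exists_weight k H fun z => if z ∈ Set.range w.emb then 1 else 0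
  have hl : ∀ a, (parityCond k H).Good (w.emb a) m := fun a ha => by simp [hm _ ha]
  -- For a substructure `S`, the weights `e S` agree with `m` at roots in `S` but forget the rest of
  -- the image. They depend on `S` alone, which gives coherence.
  choose e he he' using fun S : Set V => exists_weight_extending k H m (w.emb '' S)
  let σ : PartialAut (dStruc k G) → W → (W → ZMod 2) → W → ZMod 2 :=
    fun f => shift (w.ext f) (e f.dom.verts) (e f.ran.verts)
  have hmem := w.ext_mem_iff
  -- Here closure of substructures under the `F_n` enters: a vertex of `G` with all its roots in
  -- `S`, and at least one root, is in `S`.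
  have hin : ∀ (S : Sub (dStruc k G)) z, (rootSet k H z).Nonempty →
      rootSet k H z ⊆ w.emb '' S.verts → (z ∈ Set.range w.emb ↔ z ∈ w.emb '' S.verts) := by
    intro S z hz hzS
    refine ⟨?_, fun h => Set.image_subset_range _ _ h⟩
    rintro ⟨a, rfl⟩
    rw [w.isClosedEmb.rootSet_eq] at hz hzS
    refine ⟨a, (isClosedSet_verts S).mem_of_rootSet hz.of_image ?_, rfl⟩
    exact (Set.image_subset_image_iff w.isClosedEmb.injective).1 hzS
  have htot : ∀ (S : Sub (dStruc k G)) z, (rootSet k H z).Nonempty →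
      rootSet k H z ⊆ w.emb '' S.verts →
      total k H (e S.verts) z = if z ∈ w.emb '' S.verts then 1 else 0 := by
    intro S z hz hzS
    simp only [← hin S z hz hzS]
    rw [← hm z hz]
    exact total_congr fun r hr => he _ r (hzS hr) z
  -- If all roots of `z` are in the domain, both totals record membership, in domain and range
  -- respectively; otherwise both are zero.
  have hshift : ∀ f z, total k H (e f.ran.verts) (w.ext f z) = total k H (e f.dom.verts) z := by
    intro f z
    by_cases hz : (rootSet k H z).Nonempty
    swap
    · rw [Set.not_nonempty_iff_eq_empty] at hz
      rw [total_eq_zero hz, total_eq_zero]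
      rw [(w.ext f).isClosedEmb.rootSet_eq, hz, Set.image_empty]
    · have hz' : (rootSet k H (w.ext f z)).Nonempty := by
        rw [(w.ext f).isClosedEmb.rootSet_eq]
        exact hz.image _
      have h1 : rootSet k H (w.ext f z) ⊆ w.emb '' f.ran.verts ↔
          rootSet k H z ⊆ w.emb '' f.dom.verts := by
        rw [(w.ext f).isClosedEmb.rootSet_eq, Set.image_subset_iff]
        exact forall₂_congr fun r _ => hmem f r
      by_cases hzS : rootSet k H z ⊆ w.emb '' f.dom.verts
      · rw [htot _ _ hz hzS, htot _ _ hz' (h1.2 hzS)]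
        simp only [hmem]
      · rw [he' _ _ hzS, he' _ _ (h1.not.2 hzS)]
  have hσl : ∀ (f : PartialAut (dStruc k G)), ∀ a ∈ f.dom.verts,
      σ f (w.emb a) (m (w.emb a)) = m (w.ext f (w.emb a)) := by
    intro f a ha
    funext z
    have h1 : w.ext f (w.emb a) ∈ w.emb '' f.ran.verts := (hmem f _).2 ⟨a, ha, rfl⟩
    simp only [σ, shift]
    rw [he _ _ h1, he _ _ ⟨a, ha, rfl⟩, ← add_assoc, CharTwo.add_self_eq_zero, zero_add]
  have hcoh : ∀ f g h, IsCoherentTriple f g h →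
      ∀ r x, σ h r x = σ g (w.ext f r) (σ f r x) := by
    intro f g h hc r x
    funext z
    have h1 : (w.ext h).symm z = (w.ext f).symm ((w.ext g).symm z) := by
      rw [RelIso.symm_apply_eq, w.coherent f g h hc]
      simp
    simp only [σ, shift, h1, w.coherent f g h hc, ← hc.1, ← hc.2.1, ← hc.2.2.1]
    -- The weight belonging to the range of `f`, which is the domain of `g`, occurs twice and
    -- cancels.
    generalize e f.ran.verts (w.ext f r) ((w.ext g).symm z) = y
    have := CharTwo.add_self_eq_zero y
    linear_combination -this
  obtain ⟨w', hw'⟩ := LabelCond.exists_witness (C := parityCond k H) w hl σ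
    (fun f r => shift_injective _ _ _ _) (fun f => parityCond_shift _ (hshift f)) hσl hcoh
  refine ⟨_, inferInstance, (parityCond k H).graph, LabelCond.isKOrientation_graph hH, w', ?_, ?_⟩
  · rw [hw']
    refine LabelCond.isClosedSet_range_liftSection _ _ fun u hu _ hg => ?_
    by_contra hur
    have := hg hu
    simp [hm _ hu, hur] at this
  · intro p hp
    have hp' : rootSet k H p.1.1 = ∅ := by
      by_contra h
      obtain ⟨r, hr⟩ := Set.nonempty_iff_ne_empty.2 h
      exact Set.notMem_empty _ (hp ▸ LabelCond.restrict_mem_rootSet p hr)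
    obtain ⟨θ, hθ⟩ := hw p.1.1
    -- With zero weights the shift only transports labels, so every automorphism lifts; a rootless
    -- vertex has no label left to adjust.
    obtain ⟨Θ, hΘ⟩ := LabelCond.exists_liftIso (C := parityCond k H) θ
      (shift θ 0 0) (fun r => shift_injective _ _ _ _)
      (parityCond_shift _ fun z => by simp [total])
    refine ⟨Θ, ?_⟩
    rw [hw', LabelCond.mem_range_liftSection, (hΘ p).1, θ.isClosedEmb.rootSet_eq, hp']
    simpa using hθ

/-! ### Labels on bad sets: moving linked roots into the image -/

section Bad

variable (k : ℕ) (H : Digraph W) (N : Set W)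

/-- Sets which are not sent into `N` by any automorphism. -/
def IsBad (X : Set W) : Prop := ∀ θ : H.Adj ≃r H.Adj, ∃ r ∈ X, θ r ∉ N

variable {H N}

theorem IsBad.preimage {X : Set W} (h : IsBad H N X) (θ : H.Adj ≃r H.Adj) :
    IsBad H N (θ ⁻¹' X) := by
  intro τ
  obtain ⟨r, hr, hr'⟩ := h (θ.symm.trans τ)
  exact ⟨θ.symm r, by simpa using hr, hr'⟩

theorem IsBad.of_preimage {X : Set W} {θ : H.Adj ≃r H.Adj} (h : IsBad H N (θ ⁻¹' X)) :
    IsBad H N X := by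
  have := h.preimage θ.symm
  rwa [← Set.preimage_comp, show θ ∘ θ.symm = id from funext θ.apply_symm_apply,
    Set.preimage_id] at this

variable (N) in
/-- A point outside of `N` in each bad set. -/
noncomputable def badPoint [Nonempty W] (X : Set W) : W :=
  Classical.epsilon fun r => r ∈ X ∧ r ∉ N

theorem IsBad.badPoint_spec [Nonempty W] {X : Set W} (h : IsBad H N X) :
    badPoint N X ∈ X ∧ badPoint N X ∉ N := by
  obtain ⟨r, hr, hr'⟩ := h (RelIso.refl _)
  exact Classical.epsilon_spec (p := fun r => r ∈ X ∧ r ∉ N) ⟨r, hr, hr'⟩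

/-- Labels assign to each bad set `X` one of its points, different from `badPoint X`; on each
bad set `X`, the labels of the roots reachable from a vertex have to be distinct. -/
noncomputable def badCond [Nonempty W] (H : Digraph W) (N : Set W) :
    LabelCond k H (Set W → W) where
  -- For `X` not bad, or `r` outside `X`, the label is pinned to `r`.
  Good z l := ∀ X, (∀ r ∈ rootSet k H z, (IsBad H N X → r ∉ X) → l r X = r) ∧
    (IsBad H N X → (∀ r ∈ rootSet k H z, r ∈ X → l r X ∈ X ∧ l r X ≠ badPoint N X) ∧
      ∀ r ∈ rootSet k H z, ∀ s ∈ rootSet k H z, r ∈ X → s ∈ X → l r X = l s X → r = s)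
  congr {z l l'} h hg X := by
    refine ⟨fun r hr hrX => h r hr ▸ (hg X).1 r hr hrX, fun hX => ⟨fun r hr hrX => ?_, ?_⟩⟩
    · rw [← h r hr]
      exact ((hg X).2 hX).1 r hr hrX
    · intro r hr s hs
      rw [← h r hr, ← h s hs]
      exact ((hg X).2 hX).2 r hr s hs

/-- The relabelling along `θ` by permutations of the vertices, one for each set. -/
def permute (θ : H.Adj ≃r H.Adj) (t : Set W → Equiv.Perm W) (x : Set W → W) : Set W → W :=
  fun X => t X (x (θ ⁻¹' X))

theorem permute_injective (θ : H.Adj ≃r H.Adj) (t : Set W → Equiv.Perm W) :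
    Function.Injective (permute θ t) := by
  intro x y h
  funext X
  have h1 := congrFun h (θ.symm ⁻¹' X)
  have h2 : θ ⁻¹' (θ.symm ⁻¹' X) = X := by
    ext
    simp
  simpa only [permute, h2, EmbeddingLike.apply_eq_iff_eq] using h1

/-- The points that `θ` sends outside `X` already fill the complement of `X` under `t`, so `t` maps
the remaining points into `X`. -/
theorem mem_iff_of_eq_off {θ : H.Adj ≃r H.Adj} {t : Equiv.Perm W} {X : Set W}
    (h : ∀ v, θ v ∉ X → t v = θ v) (v : W) : t v ∈ X ↔ θ v ∈ X := by
  constructor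
  · intro hv
    by_contra hv'
    exact hv' (h v hv' ▸ hv)
  · intro hv
    by_contra hv'
    have h1 : t (θ.symm (t v)) = t v := by
      rw [h _ (by simpa using hv')]
      simp
    have h2 := t.injective h1
    rw [RelIso.symm_apply_eq] at h2
    exact hv' (h2 ▸ hv)

/-- Badness is invariant under automorphisms, and `t X` respects the sets, the bad points and the
pinned labels, which is all that admissibility mentions. -/
theorem badCond_permute [Nonempty W] (θ : H.Adj ≃r H.Adj) {t : Set W → Equiv.Perm W}
    (ht : ∀ X v, (IsBad H N X → θ v ∉ X) → t X v = θ v)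
    (ht' : ∀ X, IsBad H N X → t X (badPoint N (θ ⁻¹' X)) = badPoint N X) (z : W)
    (x : W → Set W → W) (hx : (badCond k H N).Good z x) :
    (badCond k H N).Good (θ z) fun r => permute θ t (x (θ.symm r)) := by
  intro X
  have hmem : ∀ r, r ∈ rootSet k H (θ z) → θ.symm r ∈ rootSet k H z := by
    intro r hr
    rw [← θ.isClosedEmb.mem_rootSet_iff]
    simpa using hr
  refine ⟨fun r hr hrX => ?_, fun hX => ⟨fun r hr hrX => ?_, fun r hr s hs hrX hsX h => ?_⟩⟩
  · have h1 := (hx (θ ⁻¹' X)).1 _ (hmem r hr) (by simpa using fun h => hrX (IsBad.of_preimage h))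
    simp only [permute]
    rw [h1, ht X _ (by simpa using hrX)]
    simp
  · obtain ⟨h1, h2⟩ := ((hx _).2 (hX.preimage θ)).1 _ (hmem r hr) (by simpa using hrX)
    refine ⟨(mem_iff_of_eq_off (fun v hv => ht X v fun _ => hv) _).2 h1, fun h3 => h2 ?_⟩
    exact (t X).injective (h3.trans (ht' X hX).symm)
  · have := ((hx _).2 (hX.preimage θ)).2 _ (hmem r hr) _ (hmem s hs) (by simpa using hrX)
      (by simpa using hsX) ((t X).injective h)
    exact θ.symm.injective this

open Classical in
/-- The map which agrees with `θ` except that it respects `badPoint`. -/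
noncomputable def badMap [Nonempty W] (N : Set W) (θ : H.Adj ≃r H.Adj) (X : Set W) (v : W) : W :=
  if v = badPoint N (θ ⁻¹' X) then badPoint N X else θ v

theorem badMap_badPoint [Nonempty W] (θ : H.Adj ≃r H.Adj) (X : Set W) :
    badMap N θ X (badPoint N (θ ⁻¹' X)) = badPoint N X :=
  if_pos rfl

theorem badMap_of_notMem [Nonempty W] {X : Set W} (hX : IsBad H N X) (θ : H.Adj ≃r H.Adj) {v : W}
    (hv : θ v ∉ X) : badMap N θ X v = θ v := by
  rw [badMap, if_neg]
  rintro rfl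
  exact hv (hX.preimage θ).badPoint_spec.1

theorem badMap_of_mem [Nonempty W] {X : Set W} (hX : IsBad H N X) (θ : H.Adj ≃r H.Adj) {v : W}
    (hv : v ∈ N) : badMap N θ X v = θ v := by
  rw [badMap, if_neg]
  rintro rfl
  exact (hX.preimage θ).badPoint_spec.2 hv

variable (N) in
/-- The complement of `X`, together with `badPoint X` and `S`. -/
def badDom [Nonempty W] (S X : Set W) : Set W :=
  {v | v ∉ X ∨ v = badPoint N X ∨ v ∈ S}

/-- `badDom` collects the points where a relabelling is forced: pinned labels, the bad point, and
the labels of the section over `S`. These demands do not collide, as a bad point lies in its bad set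
but outside `N`. -/
theorem bijOn_badMap [Nonempty W] {X : Set W} (hX : IsBad H N X) (θ : H.Adj ≃r H.Adj)
    {S T : Set W} (hS : S ⊆ N) (hT : T ⊆ N) (hST : ∀ v, θ v ∈ T ↔ v ∈ S) :
    Set.BijOn (badMap N θ X) (badDom N S (θ ⁻¹' X)) (badDom N T X) := by
  have hne : ∀ v ∈ badDom N S (θ ⁻¹' X), v ≠ badPoint N (θ ⁻¹' X) →
      badMap N θ X v = θ v ∧ θ v ≠ badPoint N X ∧ θ v ∈ badDom N T X := by
    rintro v (hv | hv | hv) hv'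
    · exact ⟨badMap_of_notMem hX θ hv, fun h => hv (h ▸ hX.badPoint_spec.1 :), Or.inl hv⟩
    · exact absurd hv hv'
    · have h1 := (hST v).2 hv
      exact ⟨badMap_of_mem hX θ (hS hv), fun h => hX.badPoint_spec.2 (h ▸ hT h1),
        Or.inr (Or.inr h1)⟩
  refine ⟨fun v hv => ?_, fun v hv v' hv' h => ?_, fun y hy => ?_⟩
  · by_cases h : v = badPoint N (θ ⁻¹' X)
    · rw [h, badMap_badPoint]
      exact Or.inr (Or.inl rfl)
    · obtain ⟨h1, -, h2⟩ := hne v hv h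
      rwa [h1]
  · by_cases h1 : v = badPoint N (θ ⁻¹' X) <;> by_cases h2 : v' = badPoint N (θ ⁻¹' X)
    · rw [h1, h2]
    · rw [h1, badMap_badPoint, (hne v' hv' h2).1] at h
      exact absurd h.symm (hne v' hv' h2).2.1
    · rw [h2, badMap_badPoint, (hne v hv h1).1] at h
      exact absurd h (hne v hv h1).2.1
    · rw [(hne v' hv' h2).1, (hne v hv h1).1] at h
      exact θ.injective h
  · rcases hy with hy | hy | hy
    · have h1 : θ (θ.symm y) ∉ X := by simpa using hy
      exact ⟨θ.symm y, Or.inl h1, by rw [badMap_of_notMem hX θ h1]; simp⟩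
    · exact ⟨_, Or.inr (Or.inl rfl), by rw [badMap_badPoint, hy]⟩
    · have h1 : θ.symm y ∈ S := (hST _).1 (by simpa using hy)
      exact ⟨θ.symm y, Or.inr (Or.inr h1), by rw [badMap_of_mem hX θ (hS h1)]; simp⟩

/-- Permutations which undo an injective labelling `c` of a subset of `θ ⁻¹' X`. -/
theorem exists_perm_label [Finite W] [Nonempty W] {X : Set W} (hX : IsBad H N X)
    (θ : H.Adj ≃r H.Adj) {P : Set W} (hPN : ∀ v ∈ P, θ v ∈ N) (hPX : ∀ v ∈ P, θ v ∈ X) {c : W → W}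
    (hc : Set.InjOn c P) (hcX : ∀ v ∈ P, θ (c v) ∈ X)
    (hcx : ∀ v ∈ P, c v ≠ badPoint N (θ ⁻¹' X)) :
    ∃ t : Equiv.Perm W, (∀ v, θ v ∉ X → t v = θ v) ∧
      t (badPoint N (θ ⁻¹' X)) = badPoint N X ∧ ∀ v ∈ P, t (c v) = θ v := by
  classical
  obtain ⟨E, hE, -⟩ := Equiv.Perm.exists_coherent_extension W
  have hb := hX.badPoint_spec
  have hb' : θ (badPoint N (θ ⁻¹' X)) ∈ X := (hX.preimage θ).badPoint_spec.1
  -- The inverse of `t` is prescribed first: its arguments are recognisable as points off `X`, the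
  -- bad point, or points `θ v`, whereas `c` is controlled only on `P`.
  let p : W → W := fun y => if y = badPoint N X then badPoint N (θ ⁻¹' X)
    else if y ∈ X then c (θ.symm y) else θ.symm y
  let D : Set W := badDom N (θ '' P) X
  have h1 : ∀ v, θ v ∉ X → p (θ v) = v := fun v hv => by
    have : θ v ≠ badPoint N X := fun h => hv (h ▸ hb.1)
    simp [p, hv, this]
  have h2 : p (badPoint N X) = badPoint N (θ ⁻¹' X) := by simp [p]
  have h3 : ∀ v ∈ P, p (θ v) = c v := fun v hv => by
    have : θ v ≠ badPoint N X := fun h => hb.2 (h ▸ hPN v hv)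
    simp [p, hPX v hv, this]
  have hcases : ∀ y ∈ D, (θ (p y) ∉ X ∧ y = θ (p y)) ∨
      (y = badPoint N X ∧ p y = badPoint N (θ ⁻¹' X)) ∨ ∃ v ∈ P, y = θ v ∧ p y = c v := by
    rintro y (hy | rfl | ⟨v, hv, rfl⟩)
    · obtain ⟨v, rfl⟩ := θ.surjective y
      exact Or.inl (by simpa [h1 v hy] using hy)
    · exact Or.inr (Or.inl ⟨rfl, h2⟩)
    · exact Or.inr (Or.inr ⟨v, hv, rfl, h3 v hv⟩)
  have hinj : Set.InjOn p D := by
    intro y hy y' hy' h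
    rcases hcases y hy with ⟨a, b⟩ | ⟨a, b⟩ | ⟨v, hv, a, b⟩ <;>
      rcases hcases y' hy' with ⟨a', b'⟩ | ⟨a', b'⟩ | ⟨v', hv', a', b'⟩
    · rw [b, b', h]
    · exact absurd hb' (by rwa [h, b'] at a)
    · exact absurd (hcX v' hv') (by rwa [h, b'] at a)
    · exact absurd hb' (by rwa [← h, b] at a')
    · rw [a, a']
    · exact absurd (by rw [← b', ← h, b]) (hcx v' hv')
    · exact absurd (hcX v hv) (by rwa [← h, b] at a')
    · exact absurd (by rw [← b, h, b']) (hcx v hv)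
    · rw [a, a', hc hv hv' (by rw [← b, h, b'])]
  have hs := hE _ _ _ hinj.bijOn_image
  refine ⟨(E D (p '' D) p).symm, fun v hv => ?_, ?_, fun v hv => ?_⟩ <;>
    rw [Equiv.symm_apply_eq]
  · rw [hs _ (Or.inl hv), h1 v hv]
  · rw [hs _ (Or.inr (Or.inl rfl)), h2]
  · rw [hs _ (Or.inr (Or.inr ⟨v, hv, rfl⟩)), h3 v hv]

end Bad

theorem exists_badIso [Finite W] [Nonempty W] {k : ℕ} {H : Digraph W} {N : Set W}
    [Inhabited (Set W → W)] (θ : H.Adj ≃r H.Adj) {t : Set W → Equiv.Perm W}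
    (ht : ∀ X v, (IsBad H N X → θ v ∉ X) → t X v = θ v)
    (ht' : ∀ X, IsBad H N X → t X (badPoint N (θ ⁻¹' X)) = badPoint N X) :
    ∃ Θ : (badCond k H N).graph.Adj ≃r (badCond k H N).graph.Adj, ∀ p, (Θ p).1.1 = θ p.1.1 ∧
      ∀ r ∈ rootSet k H p.1.1, ∀ X, (Θ p).1.2 (θ r) X = t X (p.1.2 r (θ ⁻¹' X)) := by
  obtain ⟨Θ, hΘ⟩ := LabelCond.exists_liftIso (C := badCond k H N) θ (fun _ => permute θ t)
    (fun _ => permute_injective θ t) (badCond_permute k θ ht ht')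
  exact ⟨Θ, fun p => ⟨(hΘ p).1, fun r hr X => congrFun ((hΘ p).2 r hr) X⟩⟩

/-- For each set of pairwise linked vertices, labelled compatibly with `badCond`, the
projection is injective and not bad. -/
theorem not_isBad_image [Finite W] [Nonempty W] {k : ℕ} {H : Digraph W} {N : Set W}
    [Inhabited (Set W → W)] {X : Set (badCond k H N).Lift}
    (hX : ∀ p ∈ X, ∀ q ∈ X, ∃ z, p ∈ rootSet k (badCond k H N).graph z ∧
      q ∈ rootSet k (badCond k H N).graph z) :
    (∀ p ∈ X, ∀ q ∈ X, p.1.1 = q.1.1 → p = q) ∧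
    (∀ Y, IsBad H N Y → ∀ p ∈ X, ∀ q ∈ X, p.1.1 ∈ Y → q.1.1 ∈ Y →
      p.1.2 p.1.1 Y = q.1.2 q.1.1 Y → p.1.1 = q.1.1) ∧
    ¬ IsBad H N ((fun p => p.1.1) '' X) := by
  have h1 : ∀ p ∈ X, ∀ q ∈ X, p.1.1 = q.1.1 → p = q := by
    intro p hp q hq h
    obtain ⟨z, hz, hz'⟩ := hX p hp q hq
    rw [LabelCond.mem_rootSet_graph] at hz hz'
    refine LabelCond.Lift.ext' h fun r hr => ?_
    rw [hz.2 r hr, hz'.2 r (h ▸ hr)]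
  have h2 : ∀ Y, IsBad H N Y → ∀ p ∈ X, ∀ q ∈ X, p.1.1 ∈ Y → q.1.1 ∈ Y →
      p.1.2 p.1.1 Y = q.1.2 q.1.1 Y → p.1.1 = q.1.1 := by
    intro Y hY p hp q hq hpY hqY h
    obtain ⟨z, hz, hz'⟩ := hX p hp q hq
    rw [LabelCond.mem_rootSet_graph] at hz hz'
    rw [hz.2 _ (mem_rootSet_self hz.1.1), hz'.2 _ (mem_rootSet_self hz'.1.1)] at h
    exact ((z.2.2 _ .refl Y).2 hY).2 _ hz.1 _ hz'.1 hpY hqY h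
  refine ⟨h1, h2, fun hbad => ?_⟩
  -- If the projection `Y` were bad, the labels at `Y` would inject `Y` into `Y` minus its bad
  -- point.
  set Y := (fun p : (badCond k H N).Lift => p.1.1) '' X with hYdef
  have h3 : ∀ u, ∃ x, u ∈ Y → ∃ p ∈ X, p.1.1 = u ∧ p.1.2 u Y = x := by
    intro u
    by_cases hu : u ∈ Y
    · obtain ⟨p, hp, rfl⟩ := hu
      exact ⟨_, fun _ => ⟨p, hp, rfl, rfl⟩⟩
    · exact ⟨u, fun h => absurd h hu⟩
  choose c hc using h3
  have hinj : Set.InjOn c Y := by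
    intro u hu v hv h
    obtain ⟨p, hp, rfl, hp'⟩ := hc u hu
    obtain ⟨q, hq, rfl, hq'⟩ := hc v hv
    exact h2 Y hbad p hp q hq hu hv (by rw [hp', hq', h])
  have hsub : c '' Y ⊆ Y \ {badPoint N Y} := by
    rintro _ ⟨u, hu, rfl⟩
    obtain ⟨p, hp, rfl, hp'⟩ := hc u hu
    obtain ⟨z, hz, -⟩ := hX p hp p hp
    rw [LabelCond.mem_rootSet_graph] at hz
    rw [← hp']
    exact ((p.2.2 _ .refl Y).2 hbad).1 _ (mem_rootSet_self hz.1.1) hu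
  have hlt := Set.ncard_sdiff_singleton_lt_of_mem hbad.badPoint_spec.1
  have hle := Set.ncard_le_ncard hsub
  rw [hinj.ncard_image] at hle
  omega

theorem exists_witness_faithful [Finite V] {k : ℕ} {G : Digraph V} (hG : IsKOrientation k G) :
    ∃ (W : Type u) (_ : Finite W) (H : Digraph W), IsKOrientation k H ∧
      ∃ w : Witness k G H, IsClosedSet k H (Set.range w.emb) ∧
        (∀ b, rootSet k H b = ∅ → ∃ θ : H.Adj ≃r H.Adj, θ b ∈ Set.range w.emb) ∧
        ∀ X : Set W, (∀ p ∈ X, rootSet k H p ⊆ X) →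
          (∀ p ∈ X, ∀ q ∈ X, ∃ z, p ∈ rootSet k H z ∧ q ∈ rootSet k H z) →
          ∃ θ : H.Adj ≃r H.Adj, ∀ p ∈ X, θ p ∈ Set.range w.emb := by
  classical
  obtain ⟨W, hW, H, hH, w, hw, hw'⟩ := exists_witness_closed hG
  rcases isEmpty_or_nonempty W with hWe | hWn
  · exact ⟨W, hW, H, hH, w, hw, hw', fun X _ _ => ⟨.refl _, fun p => isEmptyElim p⟩⟩
  have : Inhabited (Set W → W) := ⟨fun _ => Classical.arbitrary W⟩
  obtain ⟨E, hE, -, hE'⟩ := Equiv.Perm.exists_coherent_extension W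
  set N := Set.range w.emb with hN
  -- The section carries identity labels. They are admissible because roots reachable from the image
  -- lie in `N`, while bad points do not.
  have hl : ∀ a, (badCond k H N).Good (w.emb a) fun r _ => r := by
    intro a X
    refine ⟨fun _ _ _ => rfl, fun hX => ⟨fun r hr hrX => ⟨hrX, fun h => ?_⟩, fun _ _ _ _ _ _ h => h⟩⟩
    obtain ⟨b, -, hb⟩ := (w.isClosedEmb.reflTransGen_iff a r).1 hr.2
    exact hX.badPoint_spec.2 (h ▸ ⟨b, hb⟩)
  have hmem := w.ext_mem_iff
  let t : (H.Adj ≃r H.Adj) → Set W → Set W → Set W → Equiv.Perm W := fun θ S T X =>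
    if IsBad H N X then E (badDom N S (θ ⁻¹' X)) (badDom N T X) (badMap N θ X) else θ.toEquiv
  have ht : ∀ (θ : H.Adj ≃r H.Adj) S T, S ⊆ N → T ⊆ N → (∀ v, θ v ∈ T ↔ v ∈ S) →
      (∀ X v, (IsBad H N X → θ v ∉ X) → t θ S T X v = θ v) ∧
      (∀ X, IsBad H N X → t θ S T X (badPoint N (θ ⁻¹' X)) = badPoint N X) ∧
      ∀ X, ∀ v ∈ S, t θ S T X v = θ v := by
    intro θ S T hS hT hST
    refine ⟨fun X v hv => ?_, fun X hX => ?_, fun X v hv => ?_⟩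
    · by_cases hX : IsBad H N X
      · simp only [t, hX, if_true]
        rw [hE _ _ _ (bijOn_badMap hX θ hS hT hST) _ (Or.inl (hv hX)),
          badMap_of_notMem hX θ (hv hX)]
      · simp only [t, hX, if_false]
        rfl
    · simp only [t, hX, if_true]
      rw [hE _ _ _ (bijOn_badMap hX θ hS hT hST) _ (Or.inr (Or.inl rfl)), badMap_badPoint]
    · by_cases hX : IsBad H N X
      · simp only [t, hX, if_true]
        rw [hE _ _ _ (bijOn_badMap hX θ hS hT hST) _ (Or.inr (Or.inr hv)),
          badMap_of_mem hX θ (hS hv)]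
      · simp only [t, hX, if_false]
        rfl
  have htf := fun f : PartialAut (dStruc k G) => ht (w.ext f) _ _
    (Set.image_subset_range w.emb f.dom.verts) (Set.image_subset_range w.emb f.ran.verts) (hmem f)
  have hcoh : ∀ f g h, IsCoherentTriple f g h → ∀ X v,
      t (w.ext h) (w.emb '' h.dom.verts) (w.emb '' h.ran.verts) X v =
        t (w.ext g) (w.emb '' g.dom.verts) (w.emb '' g.ran.verts) X
          (t (w.ext f) (w.emb '' f.dom.verts) (w.emb '' f.ran.verts) (w.ext g ⁻¹' X) v) := by
    intro f g h hc X v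
    have hpre : w.ext h ⁻¹' X = w.ext f ⁻¹' (w.ext g ⁻¹' X) := by
      ext b
      simp [w.coherent f g h hc]
    by_cases hX : IsBad H N X
    · have hX' := hX.preimage (w.ext g)
      have hf := bijOn_badMap hX' (w.ext f) (Set.image_subset_range w.emb f.dom.verts)
        (Set.image_subset_range w.emb f.ran.verts) (hmem f)
      have hg := bijOn_badMap hX (w.ext g) (Set.image_subset_range w.emb g.dom.verts)
        (Set.image_subset_range w.emb g.ran.verts) (hmem g)
      have hh := bijOn_badMap hX (w.ext h) (Set.image_subset_range w.emb h.dom.verts)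
        (Set.image_subset_range w.emb h.ran.verts) (hmem h)
      simp only [t, hX, hX', if_true, hpre]
      rw [hpre] at hh
      rw [← hc.1, ← hc.2.1, ← hc.2.2.1] at *
      refine hE' _ _ _ _ _ _ hf hg hh ?_ v
      intro x hx
      by_cases hx' : x = badPoint N (w.ext f ⁻¹' (w.ext g ⁻¹' X))
      · rw [hx', badMap_badPoint, badMap_badPoint, ← hpre, badMap_badPoint]
      · rcases hx with hx | hx | hx
        · rw [badMap_of_notMem hX' _ hx, badMap_of_notMem hX (w.ext g) hx,
            badMap_of_notMem hX, w.coherent f g h hc]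
          rw [w.coherent f g h hc]
          exact hx
        · exact absurd hx hx'
        · have h1 := Set.image_subset_range _ _ ((hmem f x).2 hx)
          rw [badMap_of_mem hX' _ (Set.image_subset_range _ _ hx), badMap_of_mem hX (w.ext g) h1,
            badMap_of_mem hX _ (Set.image_subset_range _ _ hx), w.coherent f g h hc]
    · have hX' : ¬ IsBad H N (w.ext g ⁻¹' X) := fun h' => hX h'.of_preimage
      simp only [t, hX, hX', if_false]
      exact w.coherent f g h hc v
  obtain ⟨w₂, hw₂⟩ := LabelCond.exists_witness (C := badCond k H N) w hl
    (fun f _ => permute (w.ext f) (t (w.ext f) (w.emb '' f.dom.verts) (w.emb '' f.ran.verts)))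
    (fun f _ => permute_injective _ _)
    (fun f => badCond_permute k _ (htf f).1 (htf f).2.1)
    (fun f a ha => funext fun X => (htf f).2.2 X _ ⟨a, ha, rfl⟩)
    (fun f g h hc r x => funext fun X => by
      simp only [permute]
      rw [hcoh f g h hc, ← Set.preimage_comp]
      congr 4
      ext b
      simp [w.coherent f g h hc])
  refine ⟨_, inferInstance, (badCond k H N).graph, LabelCond.isKOrientation_graph hH, w₂,
    ?_, ?_, ?_⟩
  · rw [hw₂]
    exact LabelCond.isClosedSet_range_liftSection _ _ fun u hu hu' _ => hw.mem_of_rootSet hu hu'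
  · intro p hp
    have hp' : rootSet k H p.1.1 = ∅ := by
      by_contra h
      obtain ⟨r, hr⟩ := Set.nonempty_iff_ne_empty.2 h
      exact Set.notMem_empty _ (hp ▸ LabelCond.restrict_mem_rootSet p hr)
    obtain ⟨θ, hθ⟩ := hw' p.1.1 hp'
    -- With empty `S` and `T` there are no section labels to respect, so any automorphism lifts.
    have h1 := ht θ ∅ ∅ (Set.empty_subset _) (Set.empty_subset _) (fun _ => Iff.rfl)
    obtain ⟨Θ, hΘ⟩ := exists_badIso (k := k) θ h1.1 h1.2.1
    refine ⟨Θ, ?_⟩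
    rw [hw₂, LabelCond.mem_range_liftSection, (hΘ p).1, θ.isClosedEmb.rootSet_eq, hp']
    exact ⟨hθ, by simp⟩
  · intro X hXc hX
    obtain ⟨h1, h2, h3⟩ := not_isBad_image hX
    simp only [IsBad, not_forall, not_exists, not_and, not_not] at h3
    obtain ⟨θ, hθ⟩ := h3
    rw [Set.forall_mem_image] at hθ
    have hroot : ∀ p ∈ X, IsRoot k H p.1.1 := by
      intro p hp
      obtain ⟨z, hz, -⟩ := hX p hp p hp
      exact (LabelCond.mem_rootSet_graph.1 hz).1.1
    have hlab : ∀ u, ∃ x : Set W → W, ∀ p ∈ X, p.1.1 = u → p.1.2 u = x := by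
      intro u
      by_cases hu : ∃ p ∈ X, p.1.1 = u
      · obtain ⟨p, hp, rfl⟩ := hu
        exact ⟨_, fun q hq h => by rw [h1 q hq p hp h]⟩
      · exact ⟨fun _ => u, fun p hp h => absurd ⟨p, hp, h⟩ hu⟩
    choose c hc using hlab
    -- It remains to lift `θ` so that the labels on `X` become identity labels. For each bad `Y`
    -- this asks for a permutation undoing the injective labelling `c`.
    have hperm : ∀ Y, ∃ t : Equiv.Perm W, (∀ v, (IsBad H N Y → θ v ∉ Y) → t v = θ v) ∧
        (IsBad H N Y → t (badPoint N (θ ⁻¹' Y)) = badPoint N Y) ∧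
        (IsBad H N Y → ∀ p ∈ X, θ p.1.1 ∈ Y → t (c p.1.1 (θ ⁻¹' Y)) = θ p.1.1) := by
      intro Y
      by_cases hY : IsBad H N Y
      swap
      · exact ⟨θ.toEquiv, fun v _ => rfl, fun h => absurd h hY, fun h => absurd h hY⟩
      have hY' := hY.preimage θ
      have hgood : ∀ p ∈ X, θ p.1.1 ∈ Y →
          c p.1.1 (θ ⁻¹' Y) ∈ θ ⁻¹' Y ∧ c p.1.1 (θ ⁻¹' Y) ≠ badPoint N (θ ⁻¹' Y) := by
        intro p hp hpY
        rw [← hc _ p hp rfl]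
        exact ((p.2.2 _ .refl _).2 hY').1 _ (mem_rootSet_self (hroot p hp)) hpY
      obtain ⟨t, ht1, ht2, ht3⟩ := exists_perm_label hY θ
        (P := {v | ∃ p ∈ X, p.1.1 = v ∧ θ v ∈ Y}) (c := fun v => c v (θ ⁻¹' Y))
        (by rintro _ ⟨p, hp, rfl, -⟩; exact hθ hp)
        (by rintro _ ⟨p, hp, rfl, h⟩; exact h)
        (by
          rintro _ ⟨p, hp, rfl, hpY⟩ _ ⟨q, hq, rfl, hqY⟩ h
          simp only [← hc _ p hp rfl, ← hc _ q hq rfl] at h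
          exact h2 _ hY' p hp q hq hpY hqY h)
        (by rintro _ ⟨p, hp, rfl, h⟩; exact (hgood p hp h).1)
        (by rintro _ ⟨p, hp, rfl, h⟩; exact (hgood p hp h).2)
      exact ⟨t, fun v hv => ht1 v (hv hY), fun _ => ht2, fun _ p hp hpY => ht3 _ ⟨p, hp, rfl, hpY⟩⟩
    choose s hs1 hs2 hs3 using hperm
    obtain ⟨Θ, hΘ⟩ := exists_badIso (k := k) θ hs1 hs2
    refine ⟨Θ, fun p hp => ?_⟩
    rw [hw₂, LabelCond.mem_range_liftSection, (hΘ p).1, θ.isClosedEmb.rootSet_eq,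
      Set.forall_mem_image]
    refine ⟨hθ hp, fun r hr => funext fun Y => ?_⟩
    rw [(hΘ p).2 r hr]
    -- In the first case `r` carries the label of the restriction of `p` to `r`, which is in `X` by
    -- `hXc`; in the other the label is pinned.
    by_cases hY : IsBad H N Y ∧ θ r ∈ Y
    · have hq := hXc p hp (LabelCond.restrict_mem_rootSet p hr)
      have h4 := hs3 Y hY.1 _ hq hY.2
      have h5 := hc _ _ hq rfl
      have h6 : p.1.2 r = c r :=
        (LabelCond.Lift.mk_label (C := badCond k H N) (mem_rootSet_self hr.1)).symm.trans h5
      rw [h6]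
      exact h4
    · have h4 : p.1.2 r (θ ⁻¹' Y) = r := by
        refine (p.2.2 _ .refl _).1 r hr fun hb hrY => hY ⟨hb.of_preimage, hrY⟩
      rw [h4]
      exact hs1 Y r fun h h' => hY ⟨h, h'⟩

/-! ### Irreducible substructures -/

/-- An irreducible substructure covered by two substructures is contained in one of them. -/
theorem subset_or_subset_of_isIrreducible {k : ℕ} {H : Digraph W} {C : Sub (dStruc k H)}
    (hC : IsIrreducible C.struc) {S T : Set W} (hS : IsClosedSet k H S) (hT : IsClosedSet k H T)
    (hST : C.verts ⊆ S ∪ T) : C.verts ⊆ S ∨ C.verts ⊆ T := by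
  by_contra! hn
  have hcl : ∀ {P : Set W}, IsClosedSet k H P → ∀ {n : ℕ} (F : Ld.Functions n)
      (x : Fin n → C.verts), (∀ i, x i ∈ ((↑) ⁻¹' P : Set C.verts)) →
      C.struc.func F x ⊆ ((↑) ⁻¹' P : Set C.verts) := by
    intro P hP n F x hx y hy
    exact hP.funcD_subset F _ hx hy
  refine hC ⟨⟨(↑) ⁻¹' S, hcl hS⟩, ⟨(↑) ⁻¹' T, hcl hT⟩, ?_, ?_, ?_, ?_⟩
  · intro h
    exact hn.1 fun c hc => (Set.ext_iff.1 h ⟨c, hc⟩).2 trivial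
  · intro h
    exact hn.2 fun c hc => (Set.ext_iff.1 h ⟨c, hc⟩).2 trivial
  · exact Set.eq_univ_of_forall fun c => hST c.2
  -- Edges do not leave a closed set, and a vertex in a value of `F_n` reaches all arguments. Either
  -- way the whole tuple falls into `S` or into `T`.
  · rintro n x ⟨i, hiS, hiT⟩ ⟨j, hjT, hjS⟩
    constructor
    · intro R hR
      cases (R : Rel n)
      change H.Adj (x 0) (x 1) at hR
      rcases hST (x 0).2 with h | h
      · have h1 := hS.mem_of_adj h hR
        fin_cases j
        · exact hjS h
        · exact hjS h1
      · have h1 := hT.mem_of_adj h hR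
        fin_cases i
        · exact hiT h
        · exact hiT h1
    · intro F
      cases (F : FunD n) with
      | reach =>
        have : i = j := Subsingleton.elim _ _
        exact absurd hiS (this ▸ hjS)
      | rootClosure n hn =>
        rw [Set.eq_empty_iff_forall_notMem]
        rintro y ⟨-, hy⟩
        rw [roots_eq_rootSet] at hy
        have h1 : ∀ i, ReflTransGen H.Adj y (x i) := fun i => (hy ▸ Set.mem_range_self i :
          (x i : W) ∈ rootSet k H y).2
        rcases hST y.2 with h | h
        · exact hjS (mem_of_reflTransGen hS.mem_of_adj h (h1 j))
        · exact hiT (mem_of_reflTransGen hT.mem_of_adj h (h1 i))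

/-- If `r` were a root of `b`, it would be one of the roots required to miss `r`; but `r` reaches
itself. -/
theorem isClosedSet_notMem_rootSet {k : ℕ} {H : Digraph W} (r : W) :
    IsClosedSet k H {z | r ∉ rootSet k H z} where
  mem_of_adj ha hab hr := ha (rootSet_mono (.single hab) hr)
  mem_of_rootSet _ hb hr := hb hr (mem_rootSet_self hr.1)

theorem isClosedSet_of_rootless {k : ℕ} {H : Digraph W} {S : Set W}
    (hS : ∀ {a b}, a ∈ S → H.Adj a b → b ∈ S) (h : ∀ a ∈ S, rootSet k H a = ∅) :
    IsClosedSet k H S where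
  mem_of_adj := hS
  mem_of_rootSet {b} hb hbS := by
    obtain ⟨r, hr⟩ := hb
    exact absurd (mem_rootSet_self hr.1) (by simp [h r (hbS hr)])

theorem rootSet_eq_empty_of_reflTransGen {k : ℕ} {H : Digraph W} {a b : W}
    (h : ReflTransGen H.Adj a b) (ha : rootSet k H a = ∅) : rootSet k H b = ∅ :=
  Set.subset_empty_iff.1 (ha ▸ rootSet_mono h)

/-- An irreducible substructure without roots is generated by a vertex. -/
theorem exists_generator_of_rootless [Finite W] {k : ℕ} {H : Digraph W} {C : Sub (dStruc k H)}
    (hC : IsIrreducible C.struc) (h : ∀ c ∈ C.verts, rootSet k H c = ∅)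
    (hne : C.verts.Nonempty) : ∃ c ∈ C.verts, ∀ z ∈ C.verts, ReflTransGen H.Adj c z := by
  classical
  -- Split off one generator at a time: without roots, successor-closed sets are closed, so
  -- irreducibility discards either that generator or all the others.
  have key : ∀ s : Finset W, ↑s ⊆ C.verts →
      (∀ z ∈ C.verts, ∃ c ∈ s, ReflTransGen H.Adj c z) →
      ∃ c ∈ C.verts, ∀ z ∈ C.verts, ReflTransGen H.Adj c z := by
    intro s
    induction s using Finset.induction_on with
    | empty =>
      intro _ h1
      obtain ⟨c, hc⟩ := hne
      simpa using h1 c hc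
    | insert c s _ ih =>
      intro hs h1
      rw [Finset.coe_insert, Set.insert_subset_iff] at hs
      have hS : IsClosedSet k H {z | ReflTransGen H.Adj c z} :=
        isClosedSet_of_rootless (fun ha hab => ReflTransGen.tail ha hab)
          fun a ha => rootSet_eq_empty_of_reflTransGen ha (h c hs.1)
      have hT : IsClosedSet k H {z | ∃ c ∈ s, ReflTransGen H.Adj c z} :=
        isClosedSet_of_rootless (fun ⟨d, hd, ha⟩ hab => ⟨d, hd, ha.tail hab⟩)
          fun a ⟨d, hd, ha⟩ => rootSet_eq_empty_of_reflTransGen ha (h d (hs.2 hd))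
      rcases subset_or_subset_of_isIrreducible hC hS hT (fun z hz => by
        obtain ⟨d, hd, hdz⟩ := h1 z hz
        rcases Finset.mem_insert.1 hd with rfl | hd
        · exact Or.inl hdz
        · exact Or.inr ⟨d, hd, hdz⟩) with h2 | h2
      · exact ⟨c, hs.1, h2⟩
      · exact ih hs.2 h2
  have hfin := Set.toFinite C.verts
  exact key hfin.toFinset (by simp) fun z hz => ⟨z, by simpa using hz, .refl⟩

theorem exists_map_into_of_isIrreducible [Finite W] {k : ℕ} {H : Digraph W} {N : Set W}
    (hN : IsClosedSet k H N)
    (h1 : ∀ b, rootSet k H b = ∅ → ∃ θ : H.Adj ≃r H.Adj, θ b ∈ N)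
    (h2 : ∀ X : Set W, (∀ p ∈ X, rootSet k H p ⊆ X) →
      (∀ p ∈ X, ∀ q ∈ X, ∃ z, p ∈ rootSet k H z ∧ q ∈ rootSet k H z) →
      ∃ θ : H.Adj ≃r H.Adj, ∀ p ∈ X, θ p ∈ N)
    {C : Sub (dStruc k H)} (hC : IsIrreducible C.struc) :
    ∃ θ : H.Adj ≃r H.Adj, ∀ c ∈ C.verts, θ c ∈ N := by
  have hCc := isClosedSet_verts C
  have hCr : ∀ c ∈ C.verts, rootSet k H c ⊆ C.verts := fun c hc r hr =>
    mem_of_reflTransGen hCc.mem_of_adj hc hr.2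
  by_cases hr : ∃ r ∈ C.verts, IsRoot k H r
  · obtain ⟨r, hrC, hr⟩ := hr
    obtain ⟨θ, hθ⟩ := h2 {p | p ∈ C.verts ∧ IsRoot k H p}
      (fun p hp q hq => ⟨hCr p hp.1 hq, hq.1⟩) (fun p hp q hq => by
        -- Otherwise the closed sets of vertices missing `p` and missing `q` would cover `C`, though
        -- neither contains both `p` and `q`.
        by_contra! hpq
        rcases subset_or_subset_of_isIrreducible hC (isClosedSet_notMem_rootSet p)
          (isClosedSet_notMem_rootSet q) (fun z _ => by
            by_cases hz : p ∈ rootSet k H z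
            · exact Or.inr (hpq z hz)
            · exact Or.inl hz) with h | h
        · exact h hp.1 (mem_rootSet_self hp.2)
        · exact h hq.1 (mem_rootSet_self hq.2))
    have hT : IsClosedSet k H {z | rootSet k H z = ∅} :=
      isClosedSet_of_rootless
        (fun ha hab => rootSet_eq_empty_of_reflTransGen (.single hab) ha) fun _ h => h
    refine ⟨θ, ?_⟩
    -- Vertices reaching a root follow their roots into `N`. The rootless ones form a closed set
    -- without `r`, so irreducibility forces them into the preimage of `N` too.
    rcases subset_or_subset_of_isIrreducible hC (hN.preimage θ) hT (fun z hz => by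
      rcases Set.eq_empty_or_nonempty (rootSet k H z) with h | h
      · exact Or.inr h
      · exact Or.inl ((hN.preimage θ).mem_of_rootSet h fun r hr => hθ r ⟨hCr z hz hr, hr.1⟩))
      with h | h
    · exact h
    · have h3 : rootSet k H r = ∅ := h hrC
      exact absurd (mem_rootSet_self hr) (by simp [h3])
  · rcases C.verts.eq_empty_or_nonempty with hCe | hne
    · exact ⟨.refl _, by simp [hCe]⟩
    have h : ∀ c ∈ C.verts, rootSet k H c = ∅ := fun c hc =>
      Set.eq_empty_of_forall_notMem fun r hrc => hr ⟨r, hCr c hc hrc, hrc.1⟩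
    obtain ⟨c, hc, hcC⟩ := exists_generator_of_rootless hC h hne
    obtain ⟨θ, hθ⟩ := h1 c (h c hc)
    exact ⟨θ, fun z hz => mem_of_reflTransGen (hN.preimage θ).mem_of_adj hθ (hcC z hz)⟩

end KOrientation

theorem theorem12p8 (k : ℕ) (hk : 1 ≤ k) :
    SetValued.HasIrreducibleStructureFaithfulCoherentEPPA.{u} (L := KOrientation.Ld)
      (KOrientation.ClassD k) := by
  rintro A M ⟨hA, G, hG, rfl⟩
  obtain ⟨W, hW, H, hH, w, hw, h1, h2⟩ := KOrientation.exists_witness_faithful hG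
  refine ⟨W, KOrientation.dStruc k H, ⟨hW, H, hH, rfl⟩, w.isClosedEmb.embed hw,
    ⟨fun f => (w.ext f).aut k, w.ext_emb, w.coherent⟩, fun C hC => ?_⟩
  obtain ⟨θ, hθ⟩ := KOrientation.exists_map_into_of_isIrreducible hw h1 h2 hC
  exact ⟨θ.aut k, hθ⟩
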